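/- **Games.** Let $V$ be a finite digraph (cycles and loops allowed) whose nodes are white or gray, every gray node having outdegree at most $1$. A game is a pair $G=(V,x)$ with $x$ a node of $V$; its options are the $(V,x')$ with an arc $x\to x'$. The cartproduct $V*U$ of two such digraphs has as nodes the pairs $(x,y)\in V\times U$ that are not both gray, $(x,y)$ being gray if $x$ or $y$ is gray; there is an arc $(x,y)\to(x^*,y^*)$ iff either $x\to x^*$ in $V$ and $y=y^*$ is white, or $y\to y^*$ in $U$ and $x=x^*$ is white. The sum of $G=(V,x)$ and $H=(U,y)$, with $x,y$ white, is $G+H=(V*U,(x,y))$. Write $\oplus$ for the nim-sum, $S\oplus S'=\{s\oplus s':s\in S,\ s'\in S'\}$, $m\oplus S=\{m\oplus s:s\in S\}$. **Labelling algorithm.** White nodes carry labels $\infty$ (unassigned), $n\in\mathbb N=\{0,1,2,\dots\}$, moon, or full moon $\odot$; gray nodes carry labels $\infty$ (unassigned), new moon, full moon $\odot$, or a set $S\subseteq\mathbb N$. *Step 0.* Terminal white nodes get $0$, terminal gray nodes get new moon, all others $\infty$. *Step $n+1$* (all labels used are those of step $n$; a node to which no rule applies keeps its label). - White $x$: if some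 gray option is labelled new moon, $x$ gets $\odot$. Otherwise let $E$ be the set of all integers labelling white options of $x$, together with the union of all sets $S$ labelling gray options of $x$. If $E=\mathbb N$, $x$ gets moon. Otherwise let $m=\operatorname{mex}E$; if every unassigned option $x'$ of $x$ has a white option labelled $m$ or a gray option $x''$ with $\mathrm{Cr}(x'',m)$, then $x$ gets $m$. - Gray $x$ whose only option $x'$ is assigned: if $x'$ is labelled $\odot$, $x$ gets new moon; if new moon, $x$ gets $\odot$; if $k\in\mathbb N$, $x$ gets $\mathbb N\setminus\{k\}$; if moon, $x$ gets $\mathbb N$; if a set $S$, $x$ gets $\mathbb N\setminus S$. Here $\mathrm{Cr}(x,k)$, for gray $x$, is the least predicate that holds if $x$ is terminal, or if for the option $x'$ of $x$ one of the following holds: $x'$ is white and labelled moon, $\odot$ or an integer different from $k$; $x'$ has a white option labelled $k$; $x'$ has a gray option $x''$ with $\mathrm{Cr}(x'',k)$. The algorithm stops at the first step whose labels are not changed by the next step; the labels of that step are final. **Direct and forcing values.** $\mathbf D$ and $\mathbf F$ are the least assignments of subsets of $\mathbb N$ to nodes such that: $k\in\mathbf D(x)$ if $x$ has a white option with final label $k$,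 or a gray option $x'$ such that $k\in\mathbf D(x'')$ for every option $x''$ of $x'$; $k\in\mathbf F(x)$ if $x$ has a gray option $x'$ that has an option $x''$ which is white with final label $k$ or satisfies $k\in\mathbf F(x'')$. **Grundy value.** For $G=(V,x)$ with $x$ white, the algorithm returns $n$ if the final label of $x$ is $n\in\mathbb N$; $\odot$ if it is full moon; the lunar value $\mathrm{moon}_{\mathbf F(x)}$ if it is moon; and, if it is $\infty$, the nymphet $\mathrm{nym}_f$ if $\mathbf F(x)=\{f\}$, and $\infty_{\mathbf D(x)}$ if $\mathbf F(x)=\emptyset$ (written $\infty$ if $\mathbf D(x)=\emptyset$). If $x$ ends with label $\infty$ and $\mathbf F(x)$ has at least two elements, the algorithm returns nothing. The Grundy value $\mathcal G(G)$ is the value returned, or $\mathrm{moon}_{\mathbf F(x)}$ when nothing is returned. **Theorem.** Let $G=(V,x)$ and $H=(U,y)$ be two such games with $x$ and $y$ white. Then $\mathcal G(G+H)$ is given by the following table (rows $\mathcal G(G)$, columns $\mathcal G(H)$): $$\begin{array}{c|ccccc} + & \odot & \infty_{D'} & \mathrm{moon}_{F'} & \mathrm{nym}_{f'} & n' \\ \hline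 \odot & \odot & \odot & \odot & \odot & \odot \\ \infty_{D} & \odot & \infty & \infty_{D\oplus F'} & \infty_{f'\oplus D} & \infty_{n'\oplus D} \\ \mathrm{moon}_{F} & \odot & \infty_{F\oplus D'} & \mathrm{moon}_{F\oplus F'} & \mathrm{moon}_{f'\oplus F} & \mathrm{moon}_{n'\oplus F} \\ \mathrm{nym}_{f} & \odot & \infty_{f\oplus D'} & \mathrm{moon}_{f\oplus F'} & \mathrm{nym}_{f\oplus f'} & \mathrm{nym}_{f\oplus n'} \\ n & \odot & \infty_{n\oplus D'} & \mathrm{moon}_{n\oplus F'} & \mathrm{nym}_{n\oplus f'} & n\oplus n' \\ \end{array}$$ Moreover, if the algorithm returns values for both $G$ and $H$, then it returns a value for $G+H$ (the one in the table). -/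

import Mathlib

/-- A digraph with white and gray nodes in which every gray node has outdegree at most `1`.
The nodes outside `gray` are the white ones. Cycles and loops are allowed. -/
structure CarryOnDigraph (V : Type*) where
  Adj : V → V → Prop
  gray : Set V
  gray_outdegree_le_one : ∀ x ∈ gray, ∀ y z, Adj x y → Adj x z → y = z

namespace CarryOnDigraph

variable {V U : Type*}

/-- The cartproduct `V ∗ U`: the pairs of two gray nodes are removed, and a piece may be moved
only if the piece that stays untouched is on a white node. -/
def cartProduct (A : CarryOnDigraph V) (B : CarryOnDigraph U) :
    CarryOnDigraph {p : V × U // ¬ (p.1 ∈ A.gray ∧ p.2 ∈ B.gray)} where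
  Adj p q :=
    (A.Adj p.1.1 q.1.1 ∧ p.1.2 = q.1.2 ∧ p.1.2 ∉ B.gray) ∨
    (B.Adj p.1.2 q.1.2 ∧ p.1.1 = q.1.1 ∧ p.1.1 ∉ A.gray)
  gray := {p | p.1.1 ∈ A.gray ∨ p.1.2 ∈ B.gray}
  gray_outdegree_le_one := by
    rintro ⟨⟨x, y⟩, hp⟩ hg ⟨⟨x₁, y₁⟩, _⟩ ⟨⟨x₂, y₂⟩, _⟩ h₁ h₂
    change x ∈ A.gray ∨ y ∈ B.gray at hg
    simp only at hp h₁ h₂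
    apply Subtype.ext
    rcases hg with hg | hg
    · have hy : y ∉ B.gray := fun h => hp ⟨hg, h⟩
      rcases h₁ with ⟨a₁, e₁, _⟩ | ⟨_, _, n⟩
      · rcases h₂ with ⟨a₂, e₂, _⟩ | ⟨_, _, n⟩
        · exact Prod.ext (A.gray_outdegree_le_one x hg _ _ a₁ a₂) (e₁.symm.trans e₂)
        · exact absurd hg n
      · exact absurd hg n
    · have hx : x ∉ A.gray := fun h => hp ⟨h, hg⟩
      rcases h₁ with ⟨_, _, n⟩ | ⟨a₁, e₁, _⟩
      · exact absurd hg n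
      · rcases h₂ with ⟨_, _, n⟩ | ⟨a₂, e₂, _⟩
        · exact absurd hg n
        · exact Prod.ext (e₁.symm.trans e₂) (B.gray_outdegree_le_one y hg _ _ a₁ a₂)

/-- The node of `V ∗ U` on which `G + H` starts, for `G = (V, x)` and `H = (U, y)` with `x` and `y`
white. -/
def pair (A : CarryOnDigraph V) (B : CarryOnDigraph U) (x : V) (y : U)
    (hx : x ∉ A.gray) (_hy : y ∉ B.gray) :
    {p : V × U // ¬ (p.1 ∈ A.gray ∧ p.2 ∈ B.gray)} :=
  ⟨(x, y), fun h => hx h.1⟩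

/-- The labels used while the algorithm runs. White nodes are labelled `unassigned` (the initial
`∞`), `nim n`, `moon` or `fullMoon`; gray nodes are labelled `unassigned`, `newMoon`, `fullMoon` or
`covers S`. -/
inductive Label where
  | unassigned : Label
  | nim (n : ℕ) : Label
  | moon : Label
  | fullMoon : Label
  | newMoon : Label
  | covers (S : Set ℕ) : Label

open Classical in
/-- Step `0`. -/
noncomputable def initial (A : CarryOnDigraph V) (x : V) : Label :=
  if ∃ y, A.Adj x y then Label.unassigned
  else if x ∈ A.gray then Label.newMoon
  else Label.nim 0

/-- `A.Cr s k x`, for a gray node `x`: under the labelling `s`, a move to `x` makes `k` a protected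
value. Either `x` is terminal, or its only option `y` is a white node labelled `moon`, `fullMoon` or
by a nimber other than `k`, or from `y` there is a move to a white node labelled `k` or to a gray
node satisfying `Cr` again. As an inductive predicate it is false on infinite runs. -/
inductive Cr (A : CarryOnDigraph V) (s : V → Label) (k : ℕ) : V → Prop
  | terminal {x : V} : x ∈ A.gray → (∀ y, ¬ A.Adj x y) → Cr A s k x
  | option {x y : V} : x ∈ A.gray → A.Adj x y → y ∉ A.gray →
      (s y = Label.moon ∨ s y = Label.fullMoon ∨ ∃ n, n ≠ k ∧ s y = Label.nim n) → Cr A s k x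
  | reply {x y z : V} : x ∈ A.gray → A.Adj x y → A.Adj y z → z ∉ A.gray →
      s z = Label.nim k → Cr A s k x
  | again {x y z : V} : x ∈ A.gray → A.Adj x y → A.Adj y z → z ∈ A.gray →
      Cr A s k z → Cr A s k x

/-- The set `D ∪ P`: the nimbers labelling the white options of `x`, and the values covered by its
gray options. -/
def excluded (A : CarryOnDigraph V) (s : V → Label) (x : V) : Set ℕ :=
  {k | ∃ y, A.Adj x y ∧ y ∉ A.gray ∧ s y = Label.nim k} ∪
  {k | ∃ y, A.Adj x y ∧ y ∈ A.gray ∧ ∃ S, s y = Label.covers S ∧ k ∈ S}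

/-- Minimum excluded value (meaningful for proper subsets of `ℕ`). -/
noncomputable def mex (S : Set ℕ) : ℕ := sInf Sᶜ

/-- The option `y` (used for unassigned `y`) reverts to `m`. -/
def Reverts (A : CarryOnDigraph V) (s : V → Label) (m : ℕ) (y : V) : Prop :=
  (∃ z, A.Adj y z ∧ z ∉ A.gray ∧ s z = Label.nim m) ∨
  (∃ z, A.Adj y z ∧ z ∈ A.gray ∧ A.Cr s m z)

/-- New label of a gray node with current label `old`, given the label of its only option. -/
def grayLabel (old : Label) : Label → Label
  | Label.unassigned => old
  | Label.nim k => Label.covers {k}ᶜ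
  | Label.moon => Label.covers Set.univ
  | Label.fullMoon => Label.newMoon
  | Label.newMoon => Label.fullMoon
  | Label.covers S => Label.covers Sᶜ

open Classical in
/-- Step `n + 1`. A node to which no rule of the step applies keeps its label. -/
noncomputable def step (A : CarryOnDigraph V) (s : V → Label) (x : V) : Label :=
  if x ∈ A.gray then
    if h : ∃ y, A.Adj x y then grayLabel (s x) (s h.choose) else s x
  else if ∃ y, A.Adj x y ∧ y ∈ A.gray ∧ s y = Label.newMoon then Label.fullMoon
  else if A.excluded s x = Set.univ then Label.moon
  else if ∀ y, A.Adj x y → s y = Label.unassigned → A.Reverts s (mex (A.excluded s x)) y then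
    Label.nim (mex (A.excluded s x))
  else s x

/-- The labelling after step `n`. -/
noncomputable def stage (A : CarryOnDigraph V) : ℕ → V → Label
  | 0 => A.initial
  | n + 1 => A.step (A.stage n)

open Classical in
/-- The labelling at the final step, the first one that the next step does not change. (On a finite
digraph there is one; the value of the `else` branch is immaterial.) -/
noncomputable def final (A : CarryOnDigraph V) : V → Label :=
  if h : ∃ t, A.stage (t + 1) = A.stage t then A.stage (Nat.find h) else A.stage 0

/-- `k` is a direct value of the game on the node `x`. -/
inductive IsDirect (A : CarryOnDigraph V) (k : ℕ) : V → Prop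
  | white {x y : V} : A.Adj x y → y ∉ A.gray → A.final y = Label.nim k → IsDirect A k x
  | gray {x y : V} : A.Adj x y → y ∈ A.gray → (∀ z, A.Adj y z → IsDirect A k z) → IsDirect A k x

/-- The set `𝐃` of direct values. -/
def directValues (A : CarryOnDigraph V) (x : V) : Set ℕ := {k | A.IsDirect k x}

/-- `k` is a forcing value of the game on the node `x`. -/
inductive IsForcing (A : CarryOnDigraph V) (k : ℕ) : V → Prop
  | white {x y z : V} : A.Adj x y → y ∈ A.gray → A.Adj y z → z ∉ A.gray →
      A.final z = Label.nim k → IsForcing A k x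
  | step {x y z : V} : A.Adj x y → y ∈ A.gray → A.Adj y z → IsForcing A k z → IsForcing A k x

/-- The set `𝐅` of forcing values. -/
def forcingValues (A : CarryOnDigraph V) (x : V) : Set ℕ := {k | A.IsForcing k x}

/-- Grundy values of white nodes: full moon, `∞` adorned with `D`, moon with lunar phase `F`,
nymphet `f`, nimber `n`. -/
inductive Value where
  | fullMoon : Value
  | infinity (D : Set ℕ) : Value
  | moon (F : Set ℕ) : Value
  | nymphet (f : ℕ) : Value
  | nim (n : ℕ) : Value

/-- `S ⊕ T`, the set of all nim-sums `s ⊕ t`. -/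
def nimSum (S T : Set ℕ) : Set ℕ := Set.image2 (fun s t => s ^^^ t) S T

/-- `m ⊕ S`, the set of all nim-sums `m ⊕ s`. -/
def nimShift (m : ℕ) (S : Set ℕ) : Set ℕ := (fun s => m ^^^ s) '' S

/-- The addition table. -/
def Value.add : Value → Value → Value
  | .fullMoon, _ => .fullMoon
  | _, .fullMoon => .fullMoon
  | .infinity _, .infinity _ => .infinity ∅
  | .infinity D, .moon F' => .infinity (nimSum D F')
  | .infinity D, .nymphet f' => .infinity (nimShift f' D)
  | .infinity D, .nim n' => .infinity (nimShift n' D)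
  | .moon F, .infinity D' => .infinity (nimSum F D')
  | .moon F, .moon F' => .moon (nimSum F F')
  | .moon F, .nymphet f' => .moon (nimShift f' F)
  | .moon F, .nim n' => .moon (nimShift n' F)
  | .nymphet f, .infinity D' => .infinity (nimShift f D')
  | .nymphet f, .moon F' => .moon (nimShift f F')
  | .nymphet f, .nymphet f' => .nymphet (f ^^^ f')
  | .nymphet f, .nim n' => .nymphet (f ^^^ n')
  | .nim n, .infinity D' => .infinity (nimShift n D')
  | .nim n, .moon F' => .moon (nimShift n F')
  | .nim n, .nymphet f' => .nymphet (n ^^^ f')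
  | .nim n, .nim n' => .nim (n ^^^ n')

open Classical in
/-- The value that the algorithm returns for a white node `x`. It is `none` only if `x` ends
unassigned although it has two or more forcing values (for gray `x` it has no meaning). -/
noncomputable def output (A : CarryOnDigraph V) (x : V) : Option Value :=
  match A.final x with
  | Label.nim n => some (.nim n)
  | Label.fullMoon => some .fullMoon
  | Label.moon => some (.moon (A.forcingValues x))
  | Label.unassigned =>
      if h : ∃ f, A.forcingValues x = {f} then some (.nymphet h.choose)
      else if A.forcingValues x = ∅ then some (.infinity (A.directValues x))
      else none
  | _ => none

/-- The Grundy value of the game on a white node `x`: the value returned by the algorithm, where a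
node that ends unassigned with two or more forcing values counts as a moon, adorned with its
forcing values. -/
noncomputable def grundy (A : CarryOnDigraph V) (x : V) : Value :=
  (A.output x).getD (.moon (A.forcingValues x))

end CarryOnDigraph

/-!
The proof compares the labels with the outcomes of play. A position `(x, k)` is a node `x` played
next to a nim heap of size `k` (`Move`); `Lose` and `Win` are the positions in which the player to
move loses, respectively wins, in finitely many moves. Every label that the algorithm ever assigns
is sound for these outcomes (`sem_stage`): a node labelled `n` loses next to `n`, a moon wins next
to every heap, and so on. Since no position is both losing and winning, soundness shows that
labels are never revised, except for the upgrade of a moon to a full moon and its consequences on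
gray nodes (`stage_le_stage`). So the stages stabilise, and the final labelling satisfies the
rules that produced it.

The heart is `IsCart.good_of_lose`: if a white node `(x, y)` of a cartproduct loses next to `k`,
then `x` and `y` are labelled by numbers of nim-sum `k`. The proof is an induction on losing
positions. If `a` and `b` are the least numbers not excluded at `x` and `y`, a losing position
with `a ⊕ b ≠ k` contradicts the induction hypothesis through the usual trichotomy for nim-sums,
and one with `a ⊕ b = k` and `x` unassigned is refuted by the unassigned option of `x` that does
not revert to `a`. What the gray nodes contribute is carried by the forced runs (`Chain`): a
player on `x` may *keep* the initiative, by a move after which the opponent is forced to hand over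
a white node (`Keep`), or *pass* a white node to the opponent (`Pass`). Applied to the cartproduct
with a single terminal node, the same statement says that the algorithm finds every losing
position (`nim_of_lose`). Together with the strategy for sums of losing positions
(`IsCart.lose_xor`) this gives the labels of the sums that are numbers.

The remaining entries of the table follow from four descriptions of a white node of the sum: it is
a full moon iff one summand is (`IsCart.fullMoon_iff`); without full moons, it is a moon iff one
summand is and both have kept values (`IsCart.moon_iff`); its kept values, which are the forcing
values with the label of the node itself added, are the nim-sums of those of the summands
(`IsCart.keptValues`), because keeping the initiative in a sum means keeping it in one of the
summands; and if the second summand has no kept values, its direct values are the nim-sums of the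
kept values of the first summand and the direct values of the second (`IsCart.directValues`).
-/

namespace CarryOnDigraph

variable {V U W : Type*}

/-! ### Outcomes with a nim heap -/

/-- The moves of the game on the node `x` played next to a nim heap of size `k`. The heap may be
touched only while the piece is on a white node. -/
def Move (A : CarryOnDigraph V) (x : V) (k : ℕ) (y : V) (j : ℕ) : Prop :=
  (A.Adj x y ∧ j = k) ∨ (y = x ∧ x ∉ A.gray ∧ j < k)

/-- The player to move on the node `x` next to a nim heap of size `k` loses: after every move
`(y, j)` there is a winning reply `(f y j, g y j)`. The replies are data of the constructor so that
the predicate is a plain (not nested) inductive one. Positions of infinite play are not losing. -/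
inductive Lose (A : CarryOnDigraph V) : V → ℕ → Prop
  | intro {x : V} {k : ℕ} (f : V → ℕ → V) (g : V → ℕ → ℕ)
      (hm : ∀ y j, A.Move x k y j → A.Move y j (f y j) (g y j))
      (hl : ∀ y j, A.Move x k y j → Lose A (f y j) (g y j)) : Lose A x k

/-- The player to move on the node `x` next to a nim heap of size `k` wins. -/
def Win (A : CarryOnDigraph V) (x : V) (k : ℕ) : Prop := ∃ y j, A.Move x k y j ∧ A.Lose y j

theorem lose_iff {A : CarryOnDigraph V} {x : V} {k : ℕ} :
    A.Lose x k ↔ ∀ y j, A.Move x k y j → A.Win y j := by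
  constructor
  · rintro ⟨f, g, hm, hl⟩ y j h
    exact ⟨_, _, hm y j h, hl y j h⟩
  · intro h
    choose! f g hm using h
    exact .intro f g (fun y j e => (hm y j e).1) fun y j e => (hm y j e).2

/-- Induction on losing positions, in terms of moves and replies. -/
theorem Lose.induct {A : CarryOnDigraph V} {motive : V → ℕ → Prop}
    (step : ∀ x k, A.Lose x k →
      (∀ y j, A.Move x k y j → ∃ z i, A.Move y j z i ∧ A.Lose z i ∧ motive z i) → motive x k)
    {x : V} {k : ℕ} (h : A.Lose x k) : motive x k := by
  induction h with
  | intro f g hm hl ih =>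
    exact step _ _ (.intro f g hm hl) fun y j e => ⟨_, _, hm y j e, hl y j e, ih y j e⟩

theorem Lose.not_win {A : CarryOnDigraph V} {x : V} {k : ℕ} (h : A.Lose x k) : ¬ A.Win x k := by
  refine Lose.induct (motive := fun x k => ¬ A.Win x k) ?_ h
  rintro x k - ih ⟨y, j, hm, hl⟩
  obtain ⟨z, i, hm', _, hz⟩ := ih y j hm
  exact hz (lose_iff.1 hl z i hm')

theorem Move.adj {A : CarryOnDigraph V} {x y : V} (h : A.Adj x y) (k : ℕ) : A.Move x k y k :=
  .inl ⟨h, rfl⟩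

theorem Lose.win_of_ne {A : CarryOnDigraph V} {x : V} {k j : ℕ} (h : A.Lose x k)
    (hx : x ∉ A.gray) (hj : j ≠ k) : A.Win x j := by
  rcases lt_or_gt_of_ne hj with hj | hj
  · exact lose_iff.1 h x j (.inr ⟨rfl, hx, hj⟩)
  · exact ⟨x, k, .inr ⟨rfl, hx, hj⟩, h⟩

theorem Lose.unique {A : CarryOnDigraph V} {x : V} {k j : ℕ} (h : A.Lose x k)
    (h' : A.Lose x j) (hx : x ∉ A.gray) : j = k := by
  by_contra hj
  exact h'.not_win (h.win_of_ne hx hj)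

theorem lose_gray_iff {A : CarryOnDigraph V} {x y : V} {k : ℕ} (hx : x ∈ A.gray)
    (h : A.Adj x y) : A.Lose x k ↔ A.Win y k := by
  rw [lose_iff]
  constructor
  · exact fun H => H y k (.adj h k)
  · rintro H z j (⟨hz, rfl⟩ | ⟨-, hx', -⟩)
    · rwa [A.gray_outdegree_le_one x hx z y hz h]
    · exact absurd hx hx'

theorem win_gray_iff {A : CarryOnDigraph V} {x y : V} {k : ℕ} (hx : x ∈ A.gray)
    (h : A.Adj x y) : A.Win x k ↔ A.Lose y k := by
  constructor
  · rintro ⟨z, j, ⟨hz, rfl⟩ | ⟨-, hx', -⟩, H⟩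
    · rwa [A.gray_outdegree_le_one x hx y z h hz]
    · exact absurd hx hx'
  · exact fun H => ⟨y, k, .adj h k, H⟩

theorem lose_gray_terminal {A : CarryOnDigraph V} {x : V} (hx : x ∈ A.gray)
    (h : ∀ y, ¬ A.Adj x y) (k : ℕ) : A.Lose x k := by
  rw [lose_iff]
  rintro y j (⟨hy, -⟩ | ⟨-, hx', -⟩)
  · exact absurd hy (h y)
  · exact absurd hx hx'

/-! ### Soundness of the labels -/

/-- What a label of `x` says about the outcomes of `x` next to a nim heap. -/
def Sem (A : CarryOnDigraph V) (x : V) : Label → Prop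
  | .unassigned => True
  | .nim n => x ∉ A.gray ∧ A.Lose x n
  | .moon => x ∉ A.gray ∧ ∀ k, A.Win x k
  | .fullMoon => ∀ k, A.Win x k
  | .newMoon => x ∈ A.gray ∧ ∀ k, A.Lose x k
  | .covers S => x ∈ A.gray ∧ ∀ k, (k ∈ S → A.Lose x k) ∧ (k ∉ S → A.Win x k)

section
variable {A : CarryOnDigraph V} {s : V → Label}

theorem Cr.gray {k : ℕ} {x : V} (h : A.Cr s k x) : x ∈ A.gray := by
  cases h <;> assumption

theorem Cr.lose (hs : ∀ x, A.Sem x (s x)) {k : ℕ} {x : V} (h : A.Cr s k x) : A.Lose x k := by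
  induction h with
  | terminal hx h => exact lose_gray_terminal hx h k
  | @option x y hx hxy hy h =>
    have hsy := hs y
    rw [lose_gray_iff hx hxy]
    rcases h with h | h | ⟨n, hn, h⟩ <;> rw [h] at hsy
    · exact hsy.2 k
    · exact hsy k
    · exact hsy.2.win_of_ne hy hn.symm
  | @reply x y z hx hxy hyz hz h =>
    have hsz := hs z
    rw [h] at hsz
    exact (lose_gray_iff hx hxy).2 ⟨z, k, .adj hyz k, hsz.2⟩
  | again hx hxy hyz _ _ ih => exact (lose_gray_iff hx hxy).2 ⟨_, k, .adj hyz k, ih⟩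

theorem Reverts.win (hs : ∀ x, A.Sem x (s x)) {k : ℕ} {x : V} (h : A.Reverts s k x) :
    A.Win x k := by
  rcases h with ⟨z, hz, -, h⟩ | ⟨z, hz, -, h⟩
  · have hsz := hs z
    rw [h] at hsz
    exact ⟨z, k, .adj hz k, hsz.2⟩
  · exact ⟨z, k, .adj hz k, h.lose hs⟩

/-- An excluded number is won by a move to an option that loses at that number. -/
theorem exists_lose_of_mem_excluded (hs : ∀ x, A.Sem x (s x)) {k : ℕ} {x : V}
    (h : k ∈ A.excluded s x) : ∃ y, A.Adj x y ∧ s y ≠ .unassigned ∧ A.Lose y k ∧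
      (y ∉ A.gray → s y = .nim k) := by
  rcases h with ⟨y, hy, hg, h⟩ | ⟨y, hy, hg, S, h, hk⟩
  · have hsy := hs y
    rw [h] at hsy
    exact ⟨y, hy, by simp [h], hsy.2, fun _ => h⟩
  · have hsy := hs y
    rw [h] at hsy
    exact ⟨y, hy, by simp [h], (hsy.2 k).1 hk, fun h' => absurd hg h'⟩

theorem win_of_mem_excluded (hs : ∀ x, A.Sem x (s x)) {k : ℕ} {x : V}
    (h : k ∈ A.excluded s x) : A.Win x k :=
  let ⟨y, hy, _, hl, _⟩ := exists_lose_of_mem_excluded hs h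
  ⟨y, k, .adj hy k, hl⟩

theorem mex_notMem {S : Set ℕ} (h : S ≠ Set.univ) : mex S ∉ S :=
  Nat.sInf_mem (Set.nonempty_compl.2 h)

theorem mem_of_lt_mex {S : Set ℕ} {i : ℕ} (h : i < mex S) : i ∈ S := by
  by_contra hi
  exact absurd (Nat.sInf_le (s := Sᶜ) hi) (not_le.2 h)

theorem mex_eq {S : Set ℕ} {n : ℕ} (h : n ∉ S) (h' : ∀ i < n, i ∈ S) : mex S = n := by
  have hS : S ≠ Set.univ := by rintro rfl; exact h trivial
  rcases lt_trichotomy (mex S) n with hlt | heq | hlt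
  · exact absurd (h' _ hlt) (mex_notMem hS)
  · exact heq
  · exact absurd (mem_of_lt_mex hlt) h

theorem step_gray {x y : V} (hx : x ∈ A.gray) (h : A.Adj x y) :
    A.step s x = grayLabel (s x) (s y) := by
  have hex : ∃ y, A.Adj x y := ⟨y, h⟩
  rw [step, if_pos hx, dif_pos hex, A.gray_outdegree_le_one x hx _ _ hex.choose_spec h]

theorem step_gray_terminal {x : V} (hx : x ∈ A.gray) (h : ∀ y, ¬ A.Adj x y) :
    A.step s x = s x := by
  rw [step, if_pos hx, dif_neg (by simpa using h)]

theorem step_white {x : V} (hx : x ∉ A.gray) :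
    (∃ y, A.Adj x y ∧ y ∈ A.gray ∧ s y = .newMoon) ∧ A.step s x = .fullMoon ∨
    (¬ ∃ y, A.Adj x y ∧ y ∈ A.gray ∧ s y = .newMoon) ∧
      (A.excluded s x = Set.univ ∧ A.step s x = .moon ∨
       A.excluded s x ≠ Set.univ ∧
        ((∀ y, A.Adj x y → s y = .unassigned → A.Reverts s (mex (A.excluded s x)) y) ∧
          A.step s x = .nim (mex (A.excluded s x)) ∨
        (¬ ∀ y, A.Adj x y → s y = .unassigned → A.Reverts s (mex (A.excluded s x)) y) ∧
          A.step s x = s x)) := by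
  unfold step
  split_ifs <;> simp_all

theorem sem_step (hs : ∀ x, A.Sem x (s x)) (x : V) : A.Sem x (A.step s x) := by
  by_cases hx : x ∈ A.gray
  · by_cases hex : ∃ y, A.Adj x y
    · obtain ⟨y, hy⟩ := hex
      rw [step_gray hx hy]
      have hsy := hs y
      have hsx := hs x
      cases h : s y with
      | unassigned => exact hsx
      | nim n =>
        rw [h] at hsy
        refine ⟨hx, fun k => ⟨fun hk => ?_, fun hk => ?_⟩⟩
        · exact (lose_gray_iff hx hy).2 (hsy.2.win_of_ne hsy.1 hk)
        · obtain rfl : k = n := by simpa using hk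
          exact (win_gray_iff hx hy).2 hsy.2
      | moon =>
        rw [h] at hsy
        exact ⟨hx, fun k => ⟨fun _ => (lose_gray_iff hx hy).2 (hsy.2 k),
          fun hk => absurd trivial hk⟩⟩
      | fullMoon =>
        rw [h] at hsy
        exact ⟨hx, fun k => (lose_gray_iff hx hy).2 (hsy k)⟩
      | newMoon =>
        rw [h] at hsy
        exact fun k => (win_gray_iff hx hy).2 (hsy.2 k)
      | covers S =>
        rw [h] at hsy
        refine ⟨hx, fun k => ⟨fun hk => ?_, fun hk => ?_⟩⟩
        · exact (lose_gray_iff hx hy).2 ((hsy.2 k).2 hk)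
        · exact (win_gray_iff hx hy).2 ((hsy.2 k).1 (not_not.1 hk))
    · rw [step_gray_terminal hx (by simpa using hex)]
      exact hs x
  · rcases step_white (s := s) hx with ⟨⟨y, hy, -, h⟩, e⟩ | ⟨hnew, ⟨hE, e⟩ | ⟨hE, ⟨hr, e⟩ | ⟨-, e⟩⟩⟩
    · rw [e]
      have hsy := hs y
      rw [h] at hsy
      exact fun k => ⟨y, k, .adj hy k, hsy.2 k⟩
    · rw [e]
      exact ⟨hx, fun k => win_of_mem_excluded hs (hE ▸ trivial)⟩
    · rw [e]
      set m := mex (A.excluded s x) with hm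
      refine ⟨hx, lose_iff.2 ?_⟩
      rintro y j (⟨hy, rfl⟩ | ⟨rfl, -, hj⟩)
      · have hsy := hs y
        cases h : s y with
        | unassigned => exact (hr y hy h).win hs
        | nim n =>
          rw [h] at hsy
          refine hsy.2.win_of_ne hsy.1 ?_
          rintro rfl
          exact mex_notMem hE (.inl ⟨y, hy, hsy.1, h.trans (by rw [hm])⟩)
        | moon => rw [h] at hsy; exact hsy.2 _
        | fullMoon => rw [h] at hsy; exact hsy _
        | newMoon => rw [h] at hsy; exact absurd ⟨y, hy, hsy.1, h⟩ hnew
        | covers S =>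
          rw [h] at hsy
          refine (hsy.2 _).2 fun hk => mex_notMem hE (.inr ⟨y, hy, hsy.1, S, h, hk⟩)
      · exact win_of_mem_excluded hs (mem_of_lt_mex hj)
    · rw [e]; exact hs x

end

theorem sem_stage (A : CarryOnDigraph V) (t : ℕ) (x : V) : A.Sem x (A.stage t x) := by
  induction t generalizing x with
  | zero =>
    change A.Sem x (A.initial x)
    unfold initial
    split_ifs with h hx
    · trivial
    · exact ⟨hx, lose_gray_terminal hx (by simpa using h)⟩
    · refine ⟨hx, lose_iff.2 ?_⟩
      rintro y j (⟨hy, -⟩ | ⟨-, -, hj⟩)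
      · exact absurd ⟨y, hy⟩ h
      · exact absurd hj (Nat.not_lt_zero _)
  | succ t ih => exact sem_step ih x

/-! ### The labels only grow -/

/-- The order in which a label may change in the course of the algorithm. -/
inductive Label.Le : Label → Label → Prop
  | refl (a : Label) : Le a a
  | unassigned (a : Label) : Le .unassigned a
  | moon : Le .moon .fullMoon
  | univ : Le (.covers Set.univ) .newMoon
  | empty : Le (.covers ∅) .fullMoon

theorem Label.Le.trans {a b c : Label} (h : Label.Le a b) (h' : Label.Le b c) : Label.Le a c := by
  cases h with
  | refl => exact h'
  | unassigned => exact .unassigned _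
  | moon => cases h'; exact .moon
  | univ => cases h'; exact .univ
  | empty => cases h'; exact .empty

/-- The label of a gray node whose only option is labelled `a`. -/
def transfer (a : Label) : Label := grayLabel .unassigned a

theorem grayLabel_eq_transfer {old a : Label} (h : a ≠ .unassigned) :
    grayLabel old a = transfer a := by
  cases a <;> first | rfl | exact absurd rfl h

theorem Label.Le.transfer {a b : Label} (h : Label.Le a b) :
    Label.Le (transfer a) (transfer b) := by
  cases h with
  | refl => exact .refl _
  | unassigned => exact .unassigned _
  | moon => exact .univ
  | univ =>
    change Label.Le (.covers Set.univᶜ) _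
    rw [Set.compl_univ]
    exact .empty
  | empty =>
    change Label.Le (.covers ∅ᶜ) _
    rw [Set.compl_empty]
    exact .univ

/-- What one step does to the labels of a stage: they grow, a gray node copies the label of its
option through `transfer`, and a full moon on a white node is explained by a new moon one stage
earlier. The three facts depend on each other, so they are proved together. -/
theorem stage_succ_spec (A : CarryOnDigraph V) (t : ℕ) :
    (∀ x, Label.Le (A.stage t x) (A.stage (t + 1) x)) ∧
    (∀ x ∈ A.gray, ∀ y, A.Adj x y → A.stage (t + 1) x = transfer (A.stage t y)) ∧
    (∀ x ∉ A.gray, A.stage (t + 1) x = .fullMoon →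
      ∃ y, A.Adj x y ∧ y ∈ A.gray ∧ A.stage t y = .newMoon) := by
  -- On a white node, any change other than to the permitted labels contradicts soundness, except
  -- that `moon` and `fullMoon` say the same about outcomes.
  have key : ∀ t, ∀ x ∉ A.gray, (A.stage t x = .fullMoon → A.stage (t + 1) x = .fullMoon) →
      Label.Le (A.stage t x) (A.stage (t + 1) x) := by
    intro t x hx hfull
    have h₀ := A.sem_stage t x
    have h₁ := A.sem_stage (t + 1) x
    have hcases := step_white (s := A.stage t) hx
    change _ ∧ A.stage (t + 1) x = _ ∨ _ ∧ (_ ∧ A.stage (t + 1) x = _ ∨ _ ∧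
      (_ ∧ A.stage (t + 1) x = _ ∨ _ ∧ A.stage (t + 1) x = _)) at hcases
    cases h : A.stage t x with
    | unassigned => exact .unassigned _
    | nim n =>
      rw [h] at h₀ hcases
      rcases hcases with ⟨-, e⟩ | ⟨-, ⟨-, e⟩ | ⟨-, ⟨-, e⟩ | ⟨-, e⟩⟩⟩ <;> rw [e] at h₁ ⊢
      · exact absurd (h₁ n) h₀.2.not_win
      · exact absurd (h₁.2 n) h₀.2.not_win
      · rw [h₁.2.unique h₀.2 hx]
        exact .refl _
      · exact .refl _
    | moon =>
      rw [h] at h₀ hcases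
      rcases hcases with ⟨-, e⟩ | ⟨-, ⟨-, e⟩ | ⟨-, ⟨-, e⟩ | ⟨-, e⟩⟩⟩ <;> rw [e] at h₁ ⊢
      · exact .moon
      · exact .refl _
      · exact absurd (h₀.2 _) h₁.2.not_win
      · exact .refl _
    | fullMoon => rw [hfull h]; exact .refl _
    | newMoon => rw [h] at h₀; exact absurd h₀.1 hx
    | covers S => rw [h] at h₀; exact absurd h₀.1 hx
  induction t with
  | zero =>
    refine ⟨fun x => ?_, fun x hx y hy => ?_, fun x hx h => ?_⟩
    · by_cases hex : ∃ y, A.Adj x y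
      · have : A.stage 0 x = .unassigned := if_pos hex
        rw [this]
        exact .unassigned _
      · by_cases hx : x ∈ A.gray
        · rw [show A.stage 1 x = A.stage 0 x from step_gray_terminal hx (by simpa using hex)]
          exact .refl _
        · refine key 0 x hx fun h => ?_
          have : A.stage 0 x = .nim 0 := (if_neg hex).trans (if_neg hx)
          rw [this] at h
          cases h
    · have : A.stage 0 x = .unassigned := if_pos ⟨y, hy⟩
      exact (step_gray hx hy).trans (by rw [this]; rfl)
    · have h0 : A.stage 0 x ≠ .fullMoon := by
        change A.initial x ≠ _
        unfold initial
        split_ifs <;> simp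
      rcases step_white (s := A.stage 0) hx with ⟨h', -⟩ | ⟨-, ⟨-, e⟩ | ⟨-, ⟨-, e⟩ | ⟨-, e⟩⟩⟩
      · exact h'
      · cases e.symm.trans h
      · cases e.symm.trans h
      · exact absurd (e.symm.trans h) h0
  | succ t ih =>
    obtain ⟨hle, hgray, hfull⟩ := ih
    have hgray' : ∀ x ∈ A.gray, ∀ y, A.Adj x y →
        A.stage (t + 1 + 1) x = transfer (A.stage (t + 1) y) := by
      intro x hx y hy
      rw [show A.stage (t + 1 + 1) x = _ from step_gray hx hy]
      by_cases h : A.stage (t + 1) y = .unassigned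
      · have h' : A.stage t y = .unassigned := by
          have := hle y
          rw [h] at this
          generalize A.stage t y = a at this
          cases this <;> rfl
        rw [hgray x hx y hy, h, h']
        rfl
      · exact grayLabel_eq_transfer h
    have hnew : ∀ x, A.stage t x = .newMoon → A.stage (t + 1) x = .newMoon := by
      intro x h
      have := hle x
      rw [h] at this
      generalize A.stage (t + 1) x = a at this
      cases this; rfl
    refine ⟨fun x => ?_, hgray', fun x hx h => ?_⟩
    · by_cases hx : x ∈ A.gray
      · by_cases hex : ∃ y, A.Adj x y
        · obtain ⟨y, hy⟩ := hex
          rw [hgray' x hx y hy, hgray x hx y hy]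
          exact (hle y).transfer
        · rw [show A.stage (t + 1 + 1) x = A.stage (t + 1) x from
            step_gray_terminal hx (by simpa using hex)]
          exact .refl _
      · refine key (t + 1) x hx fun h => ?_
        obtain ⟨y, hy, hg, h'⟩ := hfull x hx h
        rcases step_white (s := A.stage (t + 1)) hx with ⟨-, e⟩ | ⟨h'', -⟩
        · exact e
        · exact absurd ⟨y, hy, hg, hnew y h'⟩ h''
    · rcases step_white (s := A.stage (t + 1)) hx with ⟨h', -⟩ | ⟨-, ⟨-, e⟩ | ⟨-, ⟨-, e⟩ | ⟨-, e⟩⟩⟩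
      · exact h'
      · cases e.symm.trans h
      · cases e.symm.trans h
      · obtain ⟨y, hy, hg, h'⟩ := hfull x hx (e.symm.trans h)
        exact ⟨y, hy, hg, hnew y h'⟩

theorem stage_le_stage (A : CarryOnDigraph V) {t u : ℕ} (h : t ≤ u) (x : V) :
    Label.Le (A.stage t x) (A.stage u x) := by
  induction u, h using Nat.le_induction with
  | base => exact .refl _
  | succ u _ ih => exact ih.trans ((A.stage_succ_spec u).1 x)

/-- A height function of the order `Label.Le`; it bounds the number of changes of a label by `2`. -/
def Label.rank : Label → ℕ
  | .unassigned => 0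
  | .moon => 1
  | .covers _ => 1
  | _ => 2

theorem Label.Le.eq_or_rank_lt {a b : Label} (h : Label.Le a b) : a = b ∨ a.rank < b.rank := by
  cases h with
  | refl => exact .inl rfl
  | unassigned => cases b <;> simp [Label.rank]
  | moon => exact .inr (by simp [Label.rank])
  | univ => exact .inr (by simp [Label.rank])
  | empty => exact .inr (by simp [Label.rank])

/-- On a finite digraph the algorithm stops. -/
theorem exists_stage_stable [Finite V] (A : CarryOnDigraph V) :
    ∃ t, A.stage (t + 1) = A.stage t := by
  classical
  have := Fintype.ofFinite V
  by_contra! h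
  have hlt : ∀ t, ∑ x, (A.stage t x).rank < ∑ x, (A.stage (t + 1) x).rank := by
    intro t
    obtain ⟨x, hx⟩ := Function.ne_iff.1 (h t)
    refine Finset.sum_lt_sum (fun y _ => ?_) ⟨x, Finset.mem_univ _, ?_⟩
    · rcases ((A.stage_succ_spec t).1 y).eq_or_rank_lt with e | e
      · rw [e]
      · exact e.le
    · exact (((A.stage_succ_spec t).1 x).eq_or_rank_lt).resolve_left (Ne.symm hx)
  have hge : ∀ t, t ≤ ∑ x, (A.stage t x).rank := by
    intro t
    induction t with
    | zero => exact Nat.zero_le _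
    | succ t ih => exact Nat.succ_le_of_lt (ih.trans_lt (hlt t))
  have hub : ∀ t, ∑ x, (A.stage t x).rank ≤ ∑ _x : V, 2 := fun t =>
    Finset.sum_le_sum fun x _ => by cases A.stage t x <;> simp [Label.rank]
  exact absurd ((hge _).trans (hub _)) (not_le.2 (Nat.lt_succ_self _))

theorem exists_final_eq_stage [Finite V] (A : CarryOnDigraph V) :
    ∃ T, A.final = A.stage T ∧ A.stage (T + 1) = A.stage T := by
  classical
  have h := A.exists_stage_stable
  exact ⟨Nat.find h, dif_pos h, Nat.find_spec h⟩

theorem step_final [Finite V] (A : CarryOnDigraph V) : A.step A.final = A.final := by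
  obtain ⟨T, h, h'⟩ := A.exists_final_eq_stage
  rw [h]
  exact h'

theorem stage_le_final [Finite V] (A : CarryOnDigraph V) (t : ℕ) (x : V) :
    Label.Le (A.stage t x) (A.final x) := by
  obtain ⟨T, h, h'⟩ := A.exists_final_eq_stage
  rcases le_total t T with ht | ht
  · rw [h]
    exact A.stage_le_stage ht x
  · have : A.stage t = A.stage T := by
      induction t, ht using Nat.le_induction with
      | base => rfl
      | succ u _ ih => rw [← h']; exact congrArg A.step ih
    rw [h, this]
    exact .refl _

/-! ### The final labelling -/

section
variable [Finite V] {A : CarryOnDigraph V}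

theorem sem_final (x : V) : A.Sem x (A.final x) := by
  obtain ⟨T, h, -⟩ := A.exists_final_eq_stage
  rw [h]
  exact A.sem_stage T x

theorem final_nim_of_stage {t : ℕ} {x : V} {n : ℕ} (h : A.stage t x = .nim n) :
    A.final x = .nim n := by
  have := A.stage_le_final t x
  rw [h] at this
  generalize A.final x = a at this
  cases this; rfl

theorem final_fullMoon_of_stage {t : ℕ} {x : V} (h : A.stage t x = .fullMoon) :
    A.final x = .fullMoon := by
  have := A.stage_le_final t x
  rw [h] at this
  generalize A.final x = a at this
  cases this; rfl

theorem final_newMoon_of_stage {t : ℕ} {x : V} (h : A.stage t x = .newMoon) :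
    A.final x = .newMoon := by
  have := A.stage_le_final t x
  rw [h] at this
  generalize A.final x = a at this
  cases this; rfl

theorem final_moon_of_stage {t : ℕ} {x : V} (h : A.stage t x = .moon) :
    A.final x = .moon ∨ A.final x = .fullMoon := by
  have := A.stage_le_final t x
  rw [h] at this
  generalize A.final x = a at this
  cases this <;> simp

theorem final_gray {x y : V} (hx : x ∈ A.gray) (h : A.Adj x y) :
    A.final x = transfer (A.final y) := by
  obtain ⟨T, e, e'⟩ := A.exists_final_eq_stage
  rw [e]
  nth_rw 1 [← e']
  exact (A.stage_succ_spec T).2.1 x hx y h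

theorem final_gray_terminal {x : V} (hx : x ∈ A.gray) (h : ∀ y, ¬ A.Adj x y) :
    A.final x = .newMoon := by
  refine final_newMoon_of_stage (t := 0) ?_
  exact (if_neg (by simpa using h)).trans (if_pos hx)

theorem final_white_terminal {x : V} (hx : x ∉ A.gray) (h : ∀ y, ¬ A.Adj x y) :
    A.final x = .nim 0 := by
  refine final_nim_of_stage (t := 0) ?_
  exact (if_neg (by simpa using h)).trans (if_neg hx)

theorem final_fullMoon_iff {x : V} (hx : x ∉ A.gray) :
    A.final x = .fullMoon ↔ ∃ y, A.Adj x y ∧ y ∈ A.gray ∧ A.final y = .newMoon := by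
  constructor
  · intro h
    obtain ⟨T, e, e'⟩ := A.exists_final_eq_stage
    rw [e, ← e'] at h
    rw [e]
    exact (A.stage_succ_spec T).2.2 x hx h
  · intro h
    rcases step_white (s := A.final) hx with ⟨-, e⟩ | ⟨h', -⟩
    · rwa [step_final] at e
    · exact absurd h h'

theorem final_white_cases {x : V} (hx : x ∉ A.gray) :
    A.final x = .unassigned ∨ (∃ n, A.final x = .nim n) ∨ A.final x = .moon ∨
      A.final x = .fullMoon := by
  have := A.sem_final x
  cases h : A.final x <;> rw [h] at this <;> simp_all [Sem]

/-- On a white node without full moon, no excluded number gets lost. -/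
theorem excluded_stage_subset {t : ℕ} {x : V} (hx : x ∉ A.gray) (h : A.final x ≠ .fullMoon) :
    A.excluded (A.stage t) x ⊆ A.excluded A.final x := by
  rintro k (⟨y, hy, hg, e⟩ | ⟨y, hy, hg, S, e, hk⟩)
  · exact .inl ⟨y, hy, hg, final_nim_of_stage e⟩
  · have hle := A.stage_le_final t y
    have hne : A.final y ≠ .newMoon := fun e' => h ((final_fullMoon_iff hx).2 ⟨y, hy, hg, e'⟩)
    rw [e] at hle
    -- A set of covered numbers that changes later on is `univ` or `∅`; the first case would lead to a
    -- full moon on `x`, and the second one covers nothing.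
    refine .inr ⟨y, hy, hg, S, ?_, hk⟩
    generalize A.final y = a at hle hne
    cases hle with
    | refl => rfl
    | univ => exact absurd rfl hne
    | empty => exact absurd hk (Set.notMem_empty k)

/-- The excluded numbers that justified a label at some stage are still excluded at the end. -/
theorem excluded_of_stage (t : ℕ) {x : V} (hx : x ∉ A.gray) (h : A.final x ≠ .fullMoon) :
    (A.stage t x = .moon → A.excluded A.final x = Set.univ) ∧
    (∀ n, A.stage t x = .nim n → ∀ i < n, i ∈ A.excluded A.final x) := by
  induction t with
  | zero =>
    have h0 : A.stage 0 x = .unassigned ∨ A.stage 0 x = .nim 0 := by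
      change A.initial x = _ ∨ A.initial x = _
      unfold initial
      split_ifs <;> simp
    rcases h0 with e | e <;> simp [e]
  | succ t ih =>
    have hsub := excluded_stage_subset (t := t) hx h
    have hcases := step_white (s := A.stage t) hx
    change _ ∧ A.stage (t + 1) x = _ ∨ _ ∧ (_ ∧ A.stage (t + 1) x = _ ∨ _ ∧
      (_ ∧ A.stage (t + 1) x = _ ∨ _ ∧ A.stage (t + 1) x = _)) at hcases
    rcases hcases with ⟨-, e⟩ | ⟨-, ⟨hE, e⟩ | ⟨-, ⟨-, e⟩ | ⟨-, e⟩⟩⟩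
    · exact absurd (final_fullMoon_of_stage e) h
    · rw [e]
      exact ⟨fun _ => Set.univ_subset_iff.1 (hE ▸ hsub), by simp⟩
    · rw [e]
      refine ⟨by simp, fun n hn i hi => hsub (mem_of_lt_mex ?_)⟩
      cases hn
      exact hi
    · rw [e]
      exact ih

theorem excluded_eq_univ_of_moon {x : V} (h : A.final x = .moon) :
    A.excluded A.final x = Set.univ := by
  obtain ⟨T, e, -⟩ := A.exists_final_eq_stage
  have hx := A.sem_final x
  rw [h] at hx
  exact (excluded_of_stage T hx.1 (by simp [h])).1 (by rw [← e, h])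

theorem moon_of_excluded_eq_univ {x : V} (hx : x ∉ A.gray) (h : A.final x ≠ .fullMoon)
    (hE : A.excluded A.final x = Set.univ) : A.final x = .moon := by
  have := step_white (s := A.final) hx
  rw [step_final] at this
  rcases this with ⟨-, e⟩ | ⟨-, ⟨-, e⟩ | ⟨hE', -⟩⟩
  · exact absurd e h
  · exact e
  · exact absurd hE hE'

theorem white_of_nim {x : V} {n : ℕ} (h : A.final x = .nim n) : x ∉ A.gray := by
  have := A.sem_final x
  rw [h] at this
  exact this.1

theorem lose_of_nim {x : V} {n : ℕ} (h : A.final x = .nim n) : A.Lose x n := by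
  have := A.sem_final x
  rw [h] at this
  exact this.2

theorem win_of_fullMoon {x : V} (h : A.final x = .fullMoon) (k : ℕ) : A.Win x k := by
  have := A.sem_final x
  rw [h] at this
  exact this k

theorem mex_excluded_of_nim {x : V} {n : ℕ} (h : A.final x = .nim n) :
    mex (A.excluded A.final x) = n := by
  obtain ⟨T, e, -⟩ := A.exists_final_eq_stage
  refine mex_eq (fun hn => (lose_of_nim h).not_win (win_of_mem_excluded sem_final hn)) ?_
  exact (excluded_of_stage T (white_of_nim h) (by simp [h])).2 n (by rw [← e, h])

theorem exists_not_reverts_of_unassigned {x : V} (hx : x ∉ A.gray)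
    (h : A.final x = .unassigned) : ∃ y, A.Adj x y ∧ A.final y = .unassigned ∧
      ¬ A.Reverts A.final (mex (A.excluded A.final x)) y := by
  have := step_white (s := A.final) hx
  rw [step_final, h] at this
  rcases this with ⟨-, e⟩ | ⟨-, ⟨-, e⟩ | ⟨-, ⟨-, e⟩ | ⟨h', -⟩⟩⟩
  · cases e
  · cases e
  · cases e
  · push Not at h'
    exact h'

end


/-! ### Forced runs through gray nodes -/

/-- The forced run that starts on the gray node `g` leaves the gray nodes at the white node `e`;
the Boolean tells whether the number of its moves is odd. -/
inductive Chain (A : CarryOnDigraph V) (e : V) : Bool → V → Prop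
  | last {g : V} : g ∈ A.gray → A.Adj g e → e ∉ A.gray → Chain A e true g
  | cons {g g' : V} {b : Bool} : g ∈ A.gray → A.Adj g g' → Chain A e b g' → Chain A e (!b) g

/-- By a move to a gray node, the player on `x` forces the opponent to hand over the white
node `e`. -/
def Keep (A : CarryOnDigraph V) (x e : V) : Prop := ∃ g, A.Adj x g ∧ A.Chain e true g

/-- By one move from `x`, directly or through a forced run, the player hands over the white
node `e`. -/
def Pass (A : CarryOnDigraph V) (x e : V) : Prop :=
  (A.Adj x e ∧ e ∉ A.gray) ∨ ∃ g, A.Adj x g ∧ A.Chain e false g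

/-- No move from `x` forces the opponent to hand over a white node. -/
def Stuck (A : CarryOnDigraph V) (x : V) : Prop := ∀ e, ¬ A.Keep x e

theorem transfer_transfer_transfer (a : Label) : transfer (transfer (transfer a)) = transfer a := by
  cases a <;> simp [transfer, grayLabel]

section
variable {A : CarryOnDigraph V}

theorem Chain.gray {e g : V} {b : Bool} (h : A.Chain e b g) : g ∈ A.gray := by
  cases h <;> assumption

theorem Chain.white {e g : V} {b : Bool} (h : A.Chain e b g) : e ∉ A.gray := by
  induction h <;> assumption

theorem Keep.white {x e : V} (h : A.Keep x e) : e ∉ A.gray := h.choose_spec.2.white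

theorem Pass.white {x e : V} (h : A.Pass x e) : e ∉ A.gray := by
  rcases h with h | ⟨g, -, h⟩
  · exact h.2
  · exact h.white

/-- Two moves along a forced run of odd length end it or lead to a shorter one. -/
theorem Chain.adj_keep {e g g' : V} (h : A.Chain e true g) (hg : A.Adj g g') :
    g' = e ∨ A.Keep g' e ∧ g' ∈ A.gray := by
  generalize hb : true = b at h
  cases h with
  | last h h' => exact .inl (A.gray_outdegree_le_one g h _ _ hg h')
  | @cons _ g₁ b h h' c =>
    obtain rfl := A.gray_outdegree_le_one g h _ _ hg h'
    obtain rfl : b = false := by simpa using hb.symm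
    generalize hb : false = b at c
    cases c with
    | last => cases hb
    | @cons _ g₂ b h₁ h₂ c =>
      obtain rfl : b = true := by simpa using hb.symm
      exact .inr ⟨⟨g₂, h₂, c⟩, h₁⟩

/-- How a gray node came to its set of covered numbers. -/
theorem exists_chain_of_covers {t : ℕ} {g : V} {S : Set ℕ} (h : A.stage t g = .covers S) :
    ∃ e b, A.Chain e b g ∧ ∃ u < t,
      ((∃ i, A.stage u e = .nim i ∧ S = if b then {i}ᶜ else {i}) ∨
        A.stage u e = .moon ∧ S = if b then Set.univ else ∅) := by
  induction t generalizing g S with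
  | zero =>
    change A.initial g = _ at h
    unfold initial at h
    split_ifs at h
  | succ t ih =>
    have hg : g ∈ A.gray := by
      have := A.sem_stage (t + 1) g
      rw [h] at this
      exact this.1
    by_cases hex : ∃ y, A.Adj g y
    · obtain ⟨y, hy⟩ := hex
      rw [(A.stage_succ_spec t).2.1 g hg y hy] at h
      have hsy := A.sem_stage t y
      cases e : A.stage t y with
      | unassigned => rw [e] at h; cases h
      | nim n =>
        rw [e] at h hsy
        cases h
        exact ⟨y, true, .last hg hy hsy.1, t, Nat.lt_succ_self t, .inl ⟨n, e, rfl⟩⟩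
      | moon =>
        rw [e] at h hsy
        cases h
        exact ⟨y, true, .last hg hy hsy.1, t, Nat.lt_succ_self t, .inr ⟨e, rfl⟩⟩
      | fullMoon => rw [e] at h; cases h
      | newMoon => rw [e] at h; cases h
      | covers S' =>
        rw [e] at h
        cases h
        obtain ⟨w, b, hc, u, hu, hw⟩ := ih e
        refine ⟨w, !b, .cons hg hy hc, u, hu.trans (Nat.lt_succ_self t), ?_⟩
        rcases hw with ⟨i, hi, rfl⟩ | ⟨hi, rfl⟩
        · exact .inl ⟨i, hi, by cases b <;> simp⟩
        · exact .inr ⟨hi, by cases b <;> simp⟩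
    · obtain ⟨e, b, hc, u, hu, hw⟩ :=
        ih ((step_gray_terminal hg (by simpa using hex)).symm.trans h)
      exact ⟨e, b, hc, u, hu.trans (Nat.lt_succ_self t), hw⟩

/-- The reasons for which a number is excluded. -/
theorem exists_end_of_mem_excluded {t k : ℕ} {x : V} (h : k ∈ A.excluded (A.stage t) x) :
    (∃ e, A.Pass x e ∧ A.stage t e = .nim k) ∨
    ∃ e, A.Keep x e ∧ ∃ u < t, (∃ i, i ≠ k ∧ A.stage u e = .nim i) ∨ A.stage u e = .moon := by
  rcases h with ⟨y, hy, hg, e⟩ | ⟨g, hy, hg, S, e, hk⟩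
  · exact .inl ⟨y, .inl ⟨hy, hg⟩, e⟩
  · obtain ⟨w, b, hc, u, hu, ⟨i, hi, rfl⟩ | ⟨hi, rfl⟩⟩ := exists_chain_of_covers e
    · cases b with
      | false =>
        obtain rfl : k = i := by simpa using hk
        refine .inl ⟨w, .inr ⟨g, hy, hc⟩, ?_⟩
        have := A.stage_le_stage hu.le w
        rw [hi] at this
        generalize A.stage t w = a at this
        cases this; rfl
      | true =>
        have hne : k ≠ i := by simpa using hk
        exact .inr ⟨w, ⟨g, hy, hc⟩, u, hu, .inl ⟨i, hne.symm, hi⟩⟩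
    · cases b with
      | false => exact absurd hk (by simp)
      | true => exact .inr ⟨w, ⟨g, hy, hc⟩, u, hu, .inr hi⟩

variable [Finite V]

theorem Chain.final_eq {e g : V} {b : Bool} (h : A.Chain e b g) :
    A.final g = if b then transfer (A.final e) else transfer (transfer (A.final e)) := by
  induction h with
  | last hg h _ => exact final_gray hg h
  | @cons g g' b hg h _ ih =>
    rw [final_gray hg h, ih]
    cases b
    · simp [transfer_transfer_transfer]
    · simp

theorem Keep.mem_excluded_of_nim {x e : V} (h : A.Keep x e) {i k : ℕ} (he : A.final e = .nim i)
    (hk : k ≠ i) : k ∈ A.excluded A.final x := by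
  obtain ⟨g, hg, hc⟩ := h
  refine .inr ⟨g, hg, hc.gray, {i}ᶜ, ?_, hk⟩
  rw [hc.final_eq, he]
  rfl

theorem Keep.mem_excluded_of_moon {x e : V} (h : A.Keep x e) (he : A.final e = .moon) (k : ℕ) :
    k ∈ A.excluded A.final x := by
  obtain ⟨g, hg, hc⟩ := h
  refine .inr ⟨g, hg, hc.gray, Set.univ, ?_, trivial⟩
  rw [hc.final_eq, he]
  rfl

theorem Keep.final_moon {x e : V} (h : A.Keep x e) (he : A.final e = .moon) (hx : x ∉ A.gray)
    (hf : A.final x ≠ .fullMoon) : A.final x = .moon :=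
  moon_of_excluded_eq_univ hx hf (Set.eq_univ_of_forall (h.mem_excluded_of_moon he))

theorem Keep.final_fullMoon {x e : V} (h : A.Keep x e) (he : A.final e = .fullMoon)
    (hx : x ∉ A.gray) : A.final x = .fullMoon := by
  obtain ⟨g, hg, hc⟩ := h
  refine (final_fullMoon_iff hx).2 ⟨g, hg, hc.gray, ?_⟩
  rw [hc.final_eq, he]
  rfl

theorem Pass.mem_excluded {x e : V} (h : A.Pass x e) {i : ℕ} (he : A.final e = .nim i) :
    i ∈ A.excluded A.final x := by
  rcases h with ⟨h, hg⟩ | ⟨g, hg, hc⟩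
  · exact .inl ⟨e, h, hg, he⟩
  · refine .inr ⟨g, hg, hc.gray, {i}, ?_, rfl⟩
    rw [hc.final_eq, he]
    simp [transfer, grayLabel]

variable (A) in
/-- Some number is the label of no node. -/
theorem exists_fresh : ∃ j, ∀ v, A.final v ≠ .nim j := by
  by_contra! h
  choose f hf using h
  refine not_injective_infinite_finite f fun i j hij => ?_
  have := (hf i).symm.trans (hij ▸ hf j)
  cases this; rfl

/-- A number that labels no node is excluded at a moon only because of an odd forced run. -/
theorem exists_keep_of_moon {x : V} (h : A.final x = .moon) : ∃ e, A.Keep x e := by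
  obtain ⟨T, e, -⟩ := A.exists_final_eq_stage
  obtain ⟨j, hj⟩ := A.exists_fresh
  have hE := excluded_eq_univ_of_moon h
  have hj' : j ∈ A.excluded (A.stage T) x := by rw [← e, hE]; trivial
  rcases exists_end_of_mem_excluded hj' with ⟨w, -, hw⟩ | ⟨w, hw, -⟩
  · exact absurd (final_nim_of_stage hw) (hj w)
  · exact ⟨w, hw⟩

end

/-! ### Cartproducts -/

/-- `C` is a cartproduct of `A` and `B` with the projections `p` and `q`. In this form the notion is
symmetric in `A` and `B`, and every digraph is a cartproduct of itself and a single white node. -/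
structure IsCart (A : CarryOnDigraph V) (B : CarryOnDigraph U) (C : CarryOnDigraph W)
    (p : W → V) (q : W → U) : Prop where
  inj : ∀ w w', p w = p w' → q w = q w' → w = w'
  surj : ∀ x y, ¬ (x ∈ A.gray ∧ y ∈ B.gray) → ∃ w, p w = x ∧ q w = y
  gray : ∀ w, w ∈ C.gray ↔ p w ∈ A.gray ∨ q w ∈ B.gray
  not_both : ∀ w, ¬ (p w ∈ A.gray ∧ q w ∈ B.gray)
  adj : ∀ w w', C.Adj w w' ↔ (A.Adj (p w) (p w') ∧ q w = q w' ∧ q w ∉ B.gray) ∨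
    (B.Adj (q w) (q w') ∧ p w = p w' ∧ p w ∉ A.gray)

theorem isCart_cartProduct (A : CarryOnDigraph V) (B : CarryOnDigraph U) :
    IsCart A B (A.cartProduct B) (fun w => w.1.1) (fun w => w.1.2) where
  inj _ _ h h' := Subtype.ext (Prod.ext h h')
  surj x y h := ⟨⟨(x, y), h⟩, rfl, rfl⟩
  gray _ := Iff.rfl
  not_both w := w.2
  adj _ _ := Iff.rfl

/-- A single white node without moves. -/
def point : CarryOnDigraph Unit where
  Adj _ _ := False
  gray := ∅
  gray_outdegree_le_one _ h := absurd h (Set.notMem_empty _)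

theorem isCart_point (A : CarryOnDigraph V) : IsCart A point A id (fun _ => ()) where
  inj _ _ h _ := h
  surj x _ _ := ⟨x, rfl, rfl⟩
  gray _ := by simp [point]
  not_both _ := by simp [point]
  adj _ _ := by simp [point]

section
variable {A : CarryOnDigraph V} {B : CarryOnDigraph U} {C : CarryOnDigraph W} {p : W → V}
  {q : W → U}

theorem IsCart.symm (hC : IsCart A B C p q) : IsCart B A C q p where
  inj w w' h h' := hC.inj w w' h' h
  surj x y h := let ⟨w, hp, hq⟩ := hC.surj y x fun h' => h h'.symm; ⟨w, hq, hp⟩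
  gray w := (hC.gray w).trans or_comm
  not_both w h := hC.not_both w h.symm
  adj w w' := (hC.adj w w').trans or_comm

theorem IsCart.finite [Finite V] [Finite U] (hC : IsCart A B C p q) : Finite W :=
  Finite.of_injective (fun w => (p w, q w)) fun w w' h =>
    hC.inj w w' (congrArg Prod.fst h) (congrArg Prod.snd h)

theorem IsCart.white (hC : IsCart A B C p q) {w : W} :
    w ∉ C.gray ↔ p w ∉ A.gray ∧ q w ∉ B.gray := by
  rw [hC.gray, not_or]

theorem IsCart.exists_left (hC : IsCart A B C p q) {w : W} (hq : q w ∉ B.gray) {x : V}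
    (h : A.Adj (p w) x) : ∃ w', p w' = x ∧ q w' = q w ∧ C.Adj w w' := by
  obtain ⟨w', h₁, h₂⟩ := hC.surj x (q w) fun h => hq h.2
  exact ⟨w', h₁, h₂, (hC.adj _ _).2 (.inl ⟨h₁ ▸ h, h₂.symm, hq⟩)⟩

/-- A forced run of the first factor lifts along a white node of the second one. -/
theorem IsCart.chain (hC : IsCart A B C p q) {e : V} {b : Bool} {g : V} (h : A.Chain e b g)
    {w w' : W} (hg : p w = g) (hq : q w ∉ B.gray) (he : p w' = e) (hq' : q w' = q w) :
    C.Chain w' b w := by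
  induction h generalizing w with
  | last h₁ h₂ h₃ =>
    refine .last ((hC.gray w).2 (.inl (hg ▸ h₁))) ?_ (hC.white.2 ⟨he ▸ h₃, hq' ▸ hq⟩)
    exact (hC.adj _ _).2 (.inl ⟨hg ▸ he ▸ h₂, hq'.symm, hq⟩)
  | cons h₁ h₂ _ ih =>
    obtain ⟨v, hv, hv', hadj⟩ := hC.exists_left hq (hg ▸ h₂)
    exact .cons ((hC.gray w).2 (.inl (hg ▸ h₁))) hadj (ih hv (hv' ▸ hq) (hq'.trans hv'.symm))

/-- A forced run of a cartproduct takes place in one factor, as the other one stays on a white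
node. -/
theorem IsCart.chain_inv (hC : IsCart A B C p q) {w' : W} {b : Bool} {w : W}
    (h : C.Chain w' b w) :
    (q w ∉ B.gray ∧ q w' = q w ∧ A.Chain (p w') b (p w)) ∨
    (p w ∉ A.gray ∧ p w' = p w ∧ B.Chain (q w') b (q w)) := by
  induction h with
  | @last w h₁ h₂ h₃ =>
    rw [hC.white] at h₃
    rw [hC.gray] at h₁
    rcases (hC.adj _ _).1 h₂ with ⟨h, e, hq⟩ | ⟨h, e, hq⟩
    · exact .inl ⟨hq, e.symm, .last (h₁.resolve_right hq) h h₃.1⟩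
    · exact .inr ⟨hq, e.symm, .last (h₁.resolve_left hq) h h₃.2⟩
  | @cons w v b h₁ h₂ c ih =>
    rw [hC.gray] at h₁
    rcases (hC.adj _ _).1 h₂ with ⟨h, e, hq⟩ | ⟨h, e, hq⟩
    · rcases ih with ⟨_, e', c'⟩ | ⟨_, _, c'⟩
      · exact .inl ⟨hq, e'.trans e.symm, .cons (h₁.resolve_right hq) h c'⟩
      · exact absurd (e ▸ c'.gray) hq
    · rcases ih with ⟨_, _, c'⟩ | ⟨_, e', c'⟩
      · exact absurd (e ▸ c'.gray) hq
      · exact .inr ⟨hq, e'.trans e.symm, .cons (h₁.resolve_left hq) h c'⟩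

theorem IsCart.keep (hC : IsCart A B C p q) {w w' : W} (hq : q w ∉ B.gray) (hq' : q w' = q w)
    (h : A.Keep (p w) (p w')) : C.Keep w w' := by
  obtain ⟨g, hg, hc⟩ := h
  obtain ⟨v, hv, hv', hadj⟩ := hC.exists_left hq hg
  exact ⟨v, hadj, hC.chain hc hv (hv' ▸ hq) rfl (hq'.trans hv'.symm)⟩

theorem IsCart.pass (hC : IsCart A B C p q) {w w' : W} (hq : q w ∉ B.gray) (hq' : q w' = q w)
    (h : A.Pass (p w) (p w')) : C.Pass w w' := by
  rcases h with ⟨h, hw⟩ | ⟨g, hg, hc⟩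
  · exact .inl ⟨(hC.adj _ _).2 (.inl ⟨h, hq'.symm, hq⟩), hC.white.2 ⟨hw, hq' ▸ hq⟩⟩
  · obtain ⟨v, hv, hv', hadj⟩ := hC.exists_left hq hg
    exact .inr ⟨v, hadj, hC.chain hc hv (hv' ▸ hq) rfl (hq'.trans hv'.symm)⟩

theorem IsCart.adj_chain_inv (hC : IsCart A B C p q) {w v w' : W} {b : Bool} (h : C.Adj w v)
    (hc : C.Chain w' b v) :
    (q w ∉ B.gray ∧ q w' = q w ∧ A.Adj (p w) (p v) ∧ A.Chain (p w') b (p v)) ∨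
    (p w ∉ A.gray ∧ p w' = p w ∧ B.Adj (q w) (q v) ∧ B.Chain (q w') b (q v)) := by
  rcases (hC.adj _ _).1 h with ⟨h, e, hq⟩ | ⟨h, e, hq⟩
  · rcases hC.chain_inv hc with ⟨_, e', c'⟩ | ⟨_, _, c'⟩
    · exact .inl ⟨hq, e'.trans e.symm, h, c'⟩
    · exact absurd (e ▸ c'.gray) hq
  · rcases hC.chain_inv hc with ⟨_, _, c'⟩ | ⟨_, e', c'⟩
    · exact absurd (e ▸ c'.gray) hq
    · exact .inr ⟨hq, e'.trans e.symm, h, c'⟩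

theorem IsCart.keep_inv (hC : IsCart A B C p q) {w w' : W} (h : C.Keep w w') :
    (q w' = q w ∧ A.Keep (p w) (p w')) ∨ (p w' = p w ∧ B.Keep (q w) (q w')) := by
  obtain ⟨v, hv, hc⟩ := h
  rcases hC.adj_chain_inv hv hc with ⟨_, e, h, c⟩ | ⟨_, e, h, c⟩
  · exact .inl ⟨e, _, h, c⟩
  · exact .inr ⟨e, _, h, c⟩

theorem IsCart.pass_inv (hC : IsCart A B C p q) {w w' : W} (h : C.Pass w w') :
    (q w' = q w ∧ A.Pass (p w) (p w')) ∨ (p w' = p w ∧ B.Pass (q w) (q w')) := by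
  rcases h with ⟨h, hw⟩ | ⟨v, hv, hc⟩
  · rw [hC.white] at hw
    rcases (hC.adj _ _).1 h with ⟨h, e, -⟩ | ⟨h, e, -⟩
    · exact .inl ⟨e.symm, .inl ⟨h, hw.1⟩⟩
    · exact .inr ⟨e.symm, .inl ⟨h, hw.2⟩⟩
  · rcases hC.adj_chain_inv hv hc with ⟨_, e, h, c⟩ | ⟨_, e, h, c⟩
    · exact .inl ⟨e, .inr ⟨_, h, c⟩⟩
    · exact .inr ⟨e, .inr ⟨_, h, c⟩⟩

/-! ### Full moons of a sum -/

/-- Full and new moons of the first factor persist next to a white node of the second one. -/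
theorem IsCart.stage_moons [Finite V] [Finite U] (hC : IsCart A B C p q) (t : ℕ) {w : W}
    (hq : q w ∉ B.gray) :
    (A.stage t (p w) = .fullMoon → C.final w = .fullMoon) ∧
    (A.stage t (p w) = .newMoon → C.final w = .newMoon) := by
  have := hC.finite
  have hterm : ∀ {w : W}, q w ∉ B.gray → p w ∈ A.gray → (∀ y, ¬ A.Adj (p w) y) →
      C.final w = .newMoon := by
    intro w _ hp h
    refine final_gray_terminal ((hC.gray w).2 (.inl hp)) fun v hv => ?_
    rcases (hC.adj _ _).1 hv with ⟨h', -⟩ | ⟨-, -, h'⟩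
    · exact h _ h'
    · exact h' hp
  have hgray : ∀ {t : ℕ} {x : V}, A.stage t x = .newMoon → x ∈ A.gray := by
    intro t x h
    have := A.sem_stage t x
    rw [h] at this
    exact this.1
  induction t generalizing w with
  | zero =>
    have h0 : A.stage 0 (p w) ≠ .fullMoon := by
      change A.initial _ ≠ _
      unfold initial
      split_ifs <;> simp
    refine ⟨fun h => absurd h h0, fun h => hterm hq (hgray h) ?_⟩
    intro y hy
    cases (if_pos ⟨y, hy⟩ : A.stage 0 (p w) = .unassigned).symm.trans h
  | succ t ih =>
    constructor
    · intro h
      by_cases hp : p w ∈ A.gray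
      · by_cases hex : ∃ x, A.Adj (p w) x
        · obtain ⟨x, hx⟩ := hex
          rw [(A.stage_succ_spec t).2.1 _ hp x hx] at h
          obtain ⟨v, hv, hv', hadj⟩ := hC.exists_left hq hx
          have : A.stage t (p v) = .newMoon := by
            rw [hv]
            revert h
            cases A.stage t x <;> simp [transfer, grayLabel]
          rw [final_gray ((hC.gray w).2 (.inl hp)) hadj, (ih (hv' ▸ hq)).2 this]
          rfl
        · exact (ih hq).1 ((step_gray_terminal hp (by simpa using hex)).symm.trans h)
      · obtain ⟨x, hx, -, h'⟩ := (A.stage_succ_spec t).2.2 _ hp h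
        obtain ⟨v, hv, hv', hadj⟩ := hC.exists_left hq hx
        refine (final_fullMoon_iff (hC.white.2 ⟨hp, hq⟩)).2 ⟨v, hadj, ?_, ?_⟩
        · exact (hC.gray v).2 (.inl (hv ▸ hgray h'))
        · exact (ih (hv' ▸ hq)).2 (hv ▸ h')
    · intro h
      have hp := hgray h
      by_cases hex : ∃ x, A.Adj (p w) x
      · obtain ⟨x, hx⟩ := hex
        rw [(A.stage_succ_spec t).2.1 _ hp x hx] at h
        obtain ⟨v, hv, hv', hadj⟩ := hC.exists_left hq hx
        have : A.stage t (p v) = .fullMoon := by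
          rw [hv]
          revert h
          cases A.stage t x <;> simp [transfer, grayLabel]
        rw [final_gray ((hC.gray w).2 (.inl hp)) hadj, (ih (hv' ▸ hq)).1 this]
        rfl
      · exact hterm hq hp (by simpa using hex)

theorem IsCart.fullMoon_left [Finite V] [Finite U] (hC : IsCart A B C p q) {w : W}
    (hq : q w ∉ B.gray)
    (h : A.final (p w) = .fullMoon) : C.final w = .fullMoon := by
  obtain ⟨T, e, -⟩ := A.exists_final_eq_stage
  exact (hC.stage_moons T hq).1 (by rw [← e, h])

/-- Full and new moons at stage `t` of a cartproduct come from the first factor, or from a full moon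
on the waiting white node of the second one. -/
def MoonsFrom (A : CarryOnDigraph V) (B : CarryOnDigraph U) (C : CarryOnDigraph W)
    (p : W → V) (q : W → U) (t : ℕ) : Prop :=
  ∀ w, q w ∉ B.gray →
    (C.stage t w = .fullMoon → A.final (p w) = .fullMoon ∨ B.final (q w) = .fullMoon) ∧
    (C.stage t w = .newMoon → p w ∈ A.gray →
      A.final (p w) = .newMoon ∨ B.final (q w) = .fullMoon)

theorem IsCart.moonsFrom_zero [Finite V] (hC : IsCart A B C p q) : MoonsFrom A B C p q 0 := by
  intro w hq
  have h0 : C.stage 0 w ≠ .fullMoon := by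
    change C.initial _ ≠ _
    unfold initial
    split_ifs <;> simp
  refine ⟨fun h => absurd h h0, fun h hp => .inl (final_gray_terminal hp fun x hx => ?_)⟩
  obtain ⟨v, -, -, hadj⟩ := hC.exists_left hq hx
  cases (if_pos ⟨v, hadj⟩ : C.stage 0 w = .unassigned).symm.trans h

variable [Finite V] [Finite U]

theorem IsCart.moonsFrom_succ (hC : IsCart A B C p q) {t : ℕ} (ih : MoonsFrom A B C p q t)
    (ih' : MoonsFrom B A C q p t) : MoonsFrom A B C p q (t + 1) := by
  intro w hq
  have hgray : ∀ {v : W}, C.stage t v = .newMoon → v ∈ C.gray := by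
    intro v h
    have := C.sem_stage t v
    rw [h] at this
    exact this.1
  constructor
  · intro h
    by_cases hp : p w ∈ A.gray
    · have hw := (hC.gray w).2 (.inl hp)
      by_cases hex : ∃ x, A.Adj (p w) x
      · obtain ⟨x, hx⟩ := hex
        obtain ⟨v, rfl, hv', hadj⟩ := hC.exists_left hq hx
        rw [(C.stage_succ_spec t).2.1 _ hw v hadj] at h
        have hnew : C.stage t v = .newMoon := by
          revert h
          cases C.stage t v <;> simp [transfer, grayLabel]
        have hpv : p v ∈ A.gray :=
          ((hC.gray v).1 (hgray hnew)).resolve_right (hv' ▸ hq)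
        rcases (ih v (hv' ▸ hq)).2 hnew hpv with e | e
        · rw [final_gray hp hx, e]
          exact .inl rfl
        · exact .inr (hv' ▸ e)
      · refine (ih w hq).1 ((step_gray_terminal hw fun v hv => ?_).symm.trans h)
        rcases (hC.adj _ _).1 hv with ⟨h', -⟩ | ⟨-, -, h'⟩
        · exact hex ⟨_, h'⟩
        · exact h' hp
    · obtain ⟨v, hv, hg, hnew⟩ := (C.stage_succ_spec t).2.2 _ (hC.white.2 ⟨hp, hq⟩) h
      rw [hC.gray] at hg
      rcases (hC.adj _ _).1 hv with ⟨h', e, -⟩ | ⟨h', e, -⟩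
      · have hpv := hg.resolve_right (e ▸ hq)
        rcases (ih v (e ▸ hq)).2 hnew hpv with e' | e'
        · exact .inl ((final_fullMoon_iff hp).2 ⟨_, h', hpv, e'⟩)
        · exact .inr (e ▸ e')
      · have hqv := hg.resolve_left (e ▸ hp)
        rcases (ih' v (e ▸ hp)).2 hnew hqv with e' | e'
        · exact .inr ((final_fullMoon_iff hq).2 ⟨_, h', hqv, e'⟩)
        · exact .inl (e ▸ e')
  · intro h hp
    have hw := (hC.gray w).2 (.inl hp)
    by_cases hex : ∃ x, A.Adj (p w) x
    · obtain ⟨x, hx⟩ := hex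
      obtain ⟨v, rfl, hv', hadj⟩ := hC.exists_left hq hx
      rw [(C.stage_succ_spec t).2.1 _ hw v hadj] at h
      have hfull : C.stage t v = .fullMoon := by
        revert h
        cases C.stage t v <;> simp [transfer, grayLabel]
      rcases (ih v (hv' ▸ hq)).1 hfull with e | e
      · rw [final_gray hp hx, e]
        exact .inl rfl
      · exact .inr (hv' ▸ e)
    · exact .inl (final_gray_terminal hp (by simpa using hex))

theorem IsCart.moonsFrom (hC : IsCart A B C p q) (t : ℕ) :
    MoonsFrom A B C p q t ∧ MoonsFrom B A C q p t := by
  induction t with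
  | zero => exact ⟨hC.moonsFrom_zero, hC.symm.moonsFrom_zero⟩
  | succ t ih => exact ⟨hC.moonsFrom_succ ih.1 ih.2, hC.symm.moonsFrom_succ ih.2 ih.1⟩

theorem IsCart.fullMoon_iff (hC : IsCart A B C p q) {w : W} (hw : w ∉ C.gray) :
    C.final w = .fullMoon ↔ A.final (p w) = .fullMoon ∨ B.final (q w) = .fullMoon := by
  have := hC.finite
  rw [hC.white] at hw
  constructor
  · intro h
    obtain ⟨T, e, -⟩ := C.exists_final_eq_stage
    exact ((hC.moonsFrom T).1 w hw.2).1 (by rw [← e, h])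
  · rintro (h | h)
    · exact hC.fullMoon_left hw.2 h
    · exact hC.symm.fullMoon_left hw.1 h

end


/-! ### Losing positions of a sum -/

/-- Both nodes are labelled by numbers, of nim-sum `k`. -/
def Numbers (A : CarryOnDigraph V) (B : CarryOnDigraph U) (x : V) (y : U) (k : ℕ) : Prop :=
  ∃ n m, A.final x = .nim n ∧ B.final y = .nim m ∧ k = n ^^^ m

/-- The number `a` is what the label of `x` has to be if it is a number, and is not excluded. -/
structure Cand (A : CarryOnDigraph V) (x : V) (a : ℕ) : Prop where
  notMem : a ∉ A.excluded A.final x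
  ne_fullMoon : A.final x ≠ .fullMoon
  eq_of_nim : ∀ n, A.final x = .nim n → n = a

/-- What a losing position `(x, y, k)` of the sum next to a nim heap says about the first summand
while the second one stays on a white node. -/
structure Half (A : CarryOnDigraph V) (B : CarryOnDigraph U) (x : V) (y : U) (k : ℕ) : Prop where
  keep : ∀ e, A.Keep x e → Numbers A B e y k
  chain : x ∈ A.gray → A.final x = .newMoon ∨ (∃ e, A.Chain e true x) ∨
    ∃ e, A.Chain e false x ∧ Numbers A B e y k
  cr : x ∈ A.gray → ∀ a b, B.Stuck y → Cand B y b → k = a ^^^ b → A.Cr A.final a x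

/-- What is to be shown about a losing position `(x, y, k)` of the sum next to a nim heap. -/
structure Good (A : CarryOnDigraph V) (B : CarryOnDigraph U) (x : V) (y : U) (k : ℕ) : Prop where
  white : x ∉ A.gray → y ∉ B.gray → Numbers A B x y k
  left : y ∉ B.gray → Half A B x y k
  right : x ∉ A.gray → Half B A y x k

/-- Some move of the sum next to a nim heap leads to a position with the property `Good`. -/
def Reply (A : CarryOnDigraph V) (B : CarryOnDigraph U) (x : V) (y : U) (k : ℕ) : Prop :=
  (∃ x', A.Adj x x' ∧ y ∉ B.gray ∧ Good A B x' y k) ∨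
  (∃ y', B.Adj y y' ∧ x ∉ A.gray ∧ Good A B x y' k) ∨
  ∃ j < k, x ∉ A.gray ∧ y ∉ B.gray ∧ Good A B x y j

section
variable {A : CarryOnDigraph V} {B : CarryOnDigraph U}

theorem Numbers.symm {x : V} {y : U} {k : ℕ} (h : Numbers A B x y k) : Numbers B A y x k := by
  obtain ⟨n, m, h₁, h₂, h₃⟩ := h
  exact ⟨m, n, h₂, h₁, h₃.trans (Nat.xor_comm _ _)⟩

theorem Good.symm {x : V} {y : U} {k : ℕ} (h : Good A B x y k) : Good B A y x k :=
  ⟨fun hy hx => (h.white hx hy).symm, h.right, h.left⟩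

theorem Reply.symm {x : V} {y : U} {k : ℕ} (h : Reply A B x y k) : Reply B A y x k := by
  rcases h with ⟨x', h, hy, H⟩ | ⟨y', h, hx, H⟩ | ⟨j, hj, hx, hy, H⟩
  · exact .inr (.inl ⟨x', h, hy, H.symm⟩)
  · exact .inl ⟨y', h, hx, H.symm⟩
  · exact .inr (.inr ⟨j, hj, hy, hx, H.symm⟩)

/-- If `x` is stuck and has the candidate `a`, a losing position after a move from `x` next to
`a ^^^ b` would exclude `a` at `x`. -/
theorem Cand.not_good [Finite V] {x x' : V} {y : U} {a b : ℕ} (ha : Cand A x a) (hx : x ∉ A.gray)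
    (hs : A.Stuck x) (hb : ∀ m, B.final y = .nim m → m = b) (hy : y ∉ B.gray)
    (h : A.Adj x x') : ¬ Good A B x' y (a ^^^ b) := by
  intro H
  by_cases hx' : x' ∈ A.gray
  · rcases (H.left hy).chain hx' with e | ⟨e, he⟩ | ⟨e, he, n, m, hn, hm, hk⟩
    · exact ha.ne_fullMoon ((final_fullMoon_iff hx).2 ⟨x', h, hx', e⟩)
    · exact hs e ⟨x', h, he⟩
    · obtain rfl := hb m hm
      obtain rfl := Nat.xor_left_inj.1 hk
      exact ha.notMem (Pass.mem_excluded (.inr ⟨x', h, he⟩) hn)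
  · obtain ⟨n, m, hn, hm, hk⟩ := H.white hx' hy
    obtain rfl := hb m hm
    obtain rfl := Nat.xor_left_inj.1 hk
    exact ha.notMem (Pass.mem_excluded (.inl ⟨h, hx'⟩) hn)

/-- Next to a stuck node with candidate `b`, a good reply at nim heap `a ^^^ b` reverts to `a`. -/
theorem Reply.reverts [Finite U] {x : V} {y : U} {a b k : ℕ} (h : Reply A B x y k) (hy : y ∉ B.gray)
    (hs : B.Stuck y) (hb : Cand B y b) (hk : k = a ^^^ b)
    (hx : x ∉ A.gray → ∀ n, A.final x = .nim n → n = a) : A.Reverts A.final a x := by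
  subst hk
  rcases h with ⟨x', h, _, H⟩ | ⟨y', h, hx', H⟩ | ⟨j, hj, hx', _, H⟩
  · by_cases hx' : x' ∈ A.gray
    · exact .inr ⟨x', h, hx', (H.left hy).cr hx' a b hs hb rfl⟩
    · obtain ⟨n, m, hn, hm, hk⟩ := H.white hx' hy
      obtain rfl := hb.eq_of_nim m hm
      obtain rfl := Nat.xor_left_inj.1 hk
      exact .inl ⟨x', h, hx', hn⟩
  · have := hb.not_good hy hs (hx hx') hx' h
    rw [Nat.xor_comm] at this
    exact absurd H.symm this
  · obtain ⟨n, m, hn, hm, rfl⟩ := H.white hx' hy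
    rw [hx hx' n hn, hb.eq_of_nim m hm] at hj
    exact absurd hj (lt_irrefl _)

variable [Finite V] [Finite U]

theorem half_of_replies {x : V} {y : U} {k : ℕ} (hy : y ∉ B.gray)
    (h : ∀ x', A.Adj x x' → Reply A B x' y k) : Half A B x y k where
  keep e he := by
    obtain ⟨g, hg, hc⟩ := he
    rcases h g hg with ⟨x', h', _, H⟩ | ⟨_, _, h', _⟩ | ⟨_, _, h', _⟩
    · rcases hc.adj_keep h' with rfl | ⟨he, _⟩
      · exact H.white hc.white hy
      · exact (H.left hy).keep e he
    · exact absurd hc.gray h'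
    · exact absurd hc.gray h'
  chain hx := by
    by_cases hex : ∃ x', A.Adj x x'
    · obtain ⟨g, hg⟩ := hex
      by_cases hgg : g ∈ A.gray
      · rcases h g hg with ⟨x', h', _, H⟩ | ⟨_, _, h', _⟩ | ⟨_, _, h', _⟩
        · by_cases hx' : x' ∈ A.gray
          · rcases (H.left hy).chain hx' with e | ⟨e, he⟩ | ⟨e, he, hN⟩
            · left
              rw [final_gray hx hg, final_gray hgg h', e]
              rfl
            · exact .inr (.inl ⟨e, .cons hx hg (.cons hgg h' he)⟩)
            · exact .inr (.inr ⟨e, .cons hx hg (.cons hgg h' he), hN⟩)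
          · exact .inr (.inr ⟨x', .cons hx hg (.last hgg h' hx'), H.white hx' hy⟩)
        · exact absurd hgg h'
        · exact absurd hgg h'
      · exact .inr (.inl ⟨g, .last hx hg hgg⟩)
    · exact .inl (final_gray_terminal hx (by simpa using hex))
  cr hx a b hs hb hk := by
    by_cases hex : ∃ x', A.Adj x x'
    · obtain ⟨x₁, h₁⟩ := hex
      by_cases hc : x₁ ∉ A.gray ∧
          (A.final x₁ = .moon ∨ A.final x₁ = .fullMoon ∨ ∃ n, n ≠ a ∧ A.final x₁ = .nim n)
      · exact .option hx h₁ hc.1 hc.2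
      · have := (h x₁ h₁).reverts hy hs hb hk fun hx₁ n hn => by
          by_contra hne
          exact hc ⟨hx₁, .inr (.inr ⟨n, hne, hn⟩)⟩
        rcases this with ⟨z, hz, hg, e⟩ | ⟨z, hz, hg, e⟩
        · exact .reply hx h₁ hz hg e
        · exact .again hx h₁ hz hg e
    · exact .terminal hx (by simpa using hex)

/-- Against a stuck node with candidate `b`, an excluded number `c` lets the opponent win at nim
heap `c ^^^ b`. -/
theorem not_replies_of_mem_excluded {x : V} {y : U} {b c k : ℕ} (hy : y ∉ B.gray)
    (hs : B.Stuck y) (hb : Cand B y b) (hk : k = c ^^^ b) (hc : c ∈ A.excluded A.final x) :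
    ¬ ∀ x', A.Adj x x' → Reply A B x' y k := by
  intro h
  obtain ⟨x₁, hx₁, -, hl, hw⟩ := exists_lose_of_mem_excluded sem_final hc
  refine hl.not_win (((h x₁ hx₁).reverts hy hs hb hk fun hg n hn => ?_).win sem_final)
  cases (hw hg).symm.trans hn
  rfl

/-- A moon keeps the initiative until the other summand shows a number `m`; then the number
`k ^^^ m`, which is excluded at the moon, provides a move without a reply. -/
theorem ne_moon_of_replies {x : V} {y : U} {k : ℕ} (hx : x ∉ A.gray) (hy : y ∉ B.gray)
    (hyf : B.final y ≠ .fullMoon)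
    (h₁ : ∀ x', A.Adj x x' → Reply A B x' y k) (h₂ : ∀ y', B.Adj y y' → Reply A B x y' k) :
    A.final x ≠ .moon := by
  intro hm
  obtain ⟨e, he⟩ := exists_keep_of_moon hm
  obtain ⟨_, m, _, hm', _⟩ := (half_of_replies hy h₁).keep e he
  have hs : B.Stuck y := by
    intro e he
    obtain ⟨_, n, _, hn, _⟩ := (half_of_replies hx fun y' h => (h₂ y' h).symm).keep e he
    cases hm.symm.trans hn
  have hb : Cand B y m := by
    refine ⟨fun hmem => ?_, hyf, fun n hn => ?_⟩
    · exact (lose_of_nim hm').not_win (win_of_mem_excluded sem_final hmem)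
    · cases hm'.symm.trans hn
      rfl
  refine not_replies_of_mem_excluded (c := k ^^^ m) hy hs hb ?_ ?_ h₁
  · rw [Nat.xor_assoc, Nat.xor_self, Nat.xor_zero]
  · rw [excluded_eq_univ_of_moon hm]
    trivial

theorem cand_mex {x : V} (hx : x ∉ A.gray) (hf : A.final x ≠ .fullMoon)
    (hm : A.final x ≠ .moon) : Cand A x (mex (A.excluded A.final x)) :=
  ⟨mex_notMem fun h => hm (moon_of_excluded_eq_univ hx hf h), hf,
    fun _ h => (mex_excluded_of_nim h).symm⟩

/-- An unassigned node has an unassigned option that does not revert to its candidate, and against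
the move to that option there would be no reply. -/
theorem exists_nim_of_replies {x : V} {y : U} {k a b : ℕ} (hx : x ∉ A.gray) (hy : y ∉ B.gray)
    (hxf : A.final x ≠ .fullMoon) (hxm : A.final x ≠ .moon)
    (ha : mex (A.excluded A.final x) = a) (hb : Cand B y b) (hk : k = a ^^^ b)
    (h₁ : ∀ x', A.Adj x x' → Reply A B x' y k) (h₂ : ∀ y', B.Adj y y' → Reply A B x y' k) :
    ∃ n, A.final x = .nim n := by
  rcases final_white_cases hx with hu | h | h | h
  · exfalso
    have hs : B.Stuck y := by
      intro e he
      obtain ⟨_, n, _, hn, _⟩ := (half_of_replies hx fun y' h => (h₂ y' h).symm).keep e he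
      cases hu.symm.trans hn
    obtain ⟨x₁, hx₁, hu₁, hr⟩ := exists_not_reverts_of_unassigned hx hu
    rw [ha] at hr
    refine hr ((h₁ x₁ hx₁).reverts hy hs hb hk fun _ n hn => ?_)
    cases hu₁.symm.trans hn
  · exact h
  · exact absurd h hxm
  · exact absurd h hxf

/-- Keeping the initiative from `x` leads to a number other than `a`, so it would exclude `a`. -/
theorem stuck_of_replies {x : V} {y : U} {k a b : ℕ} (hy : y ∉ B.gray)
    (ha : a ∉ A.excluded A.final x) (hb : Cand B y b) (hk : k ≠ a ^^^ b)
    (h₁ : ∀ x', A.Adj x x' → Reply A B x' y k) : A.Stuck x := by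
  intro e he
  obtain ⟨i, m, hi, hm, rfl⟩ := (half_of_replies hy h₁).keep e he
  obtain rfl := hb.eq_of_nim m hm
  by_cases hia : a = i
  · exact hk (by rw [hia])
  · exact ha (he.mem_excluded_of_nim hi hia)

theorem numbers_of_replies {x : V} {y : U} {k : ℕ} (hx : x ∉ A.gray) (hy : y ∉ B.gray)
    (hxf : A.final x ≠ .fullMoon) (hyf : B.final y ≠ .fullMoon)
    (h₁ : ∀ x', A.Adj x x' → Reply A B x' y k) (h₂ : ∀ y', B.Adj y y' → Reply A B x y' k)
    (h₃ : ∀ j < k, Reply A B x y j) : Numbers A B x y k := by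
  have h₁' : ∀ x', A.Adj x x' → Reply B A y x' k := fun x' h => (h₁ x' h).symm
  have h₂' : ∀ y', B.Adj y y' → Reply B A y' x k := fun y' h => (h₂ y' h).symm
  have hxm := ne_moon_of_replies hx hy hyf h₁ h₂
  have hym := ne_moon_of_replies hy hx hxf h₂' h₁'
  have ha := cand_mex hx hxf hxm
  have hb := cand_mex hy hyf hym
  have hltA := fun i => mem_of_lt_mex (S := A.excluded A.final x) (i := i)
  have hltB := fun i => mem_of_lt_mex (S := B.excluded B.final y) (i := i)
  generalize hea : mex (A.excluded A.final x) = a at *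
  generalize heb : mex (B.excluded B.final y) = b at *
  by_cases hk : k = a ^^^ b
  · obtain ⟨n, hn⟩ := exists_nim_of_replies hx hy hxf hxm hea hb hk h₁ h₂
    obtain ⟨m, hm⟩ := exists_nim_of_replies hy hx hyf hym heb ha
      (hk.trans (Nat.xor_comm _ _)) h₂' h₁'
    exact ⟨n, m, hn, hm, by rw [hk, ha.eq_of_nim n hn, hb.eq_of_nim m hm]⟩
  · exfalso
    have hk' : k ≠ b ^^^ a := fun h => hk (h.trans (Nat.xor_comm _ _))
    have hsx := stuck_of_replies hy ha.notMem hb hk h₁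
    have hsy := stuck_of_replies hx hb.notMem ha hk' h₂'
    have hne : a ^^^ b ^^^ k ≠ 0 := fun h => hk (Nat.xor_eq_zero_iff.1 h).symm
    -- One of `b ^^^ k < a`, `k ^^^ a < b`, `a ^^^ b < k` holds. In the first two cases a number below
    -- a candidate is excluded and gives a move without a reply, in the last one the unanswered move
    -- reduces the heap to `a ^^^ b`.
    rcases Nat.xor_trichotomy hne with h | h | h
    · refine not_replies_of_mem_excluded (c := b ^^^ k) hy hsy hb ?_ (hltA _ h) h₁
      rw [Nat.xor_comm b k, Nat.xor_assoc, Nat.xor_self, Nat.xor_zero]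
    · refine not_replies_of_mem_excluded (c := k ^^^ a) hx hsx ha ?_ (hltB _ h) h₂'
      rw [Nat.xor_assoc, Nat.xor_self, Nat.xor_zero]
    · rcases h₃ _ h with ⟨x', h', -, H⟩ | ⟨y', h', -, H⟩ | ⟨j, hj, -, -, H⟩
      · exact ha.not_good hx hsx hb.eq_of_nim hy h' H
      · refine hb.not_good hy hsy ha.eq_of_nim hx h' ?_
        rw [Nat.xor_comm]
        exact H.symm
      · obtain ⟨n, m, hn, hm, rfl⟩ := H.white hx hy
        rw [ha.eq_of_nim n hn, hb.eq_of_nim m hm] at hj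
        exact absurd hj (lt_irrefl _)

variable {C : CarryOnDigraph W} {p : W → V} {q : W → U}

theorem IsCart.good_of_lose (hC : IsCart A B C p q) {w : W} {k : ℕ} (h : C.Lose w k) :
    Good A B (p w) (q w) k := by
  have := hC.finite
  refine Lose.induct (motive := fun w k => Good A B (p w) (q w) k) ?_ h
  clear h w k
  intro w k hl ih
  have hreply : ∀ v j, C.Move w k v j → Reply A B (p v) (q v) j := by
    intro v j hv
    obtain ⟨z, i, hz, -, H⟩ := ih v j hv
    rcases hz with ⟨hz, rfl⟩ | ⟨rfl, hg, hi⟩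
    · rcases (hC.adj _ _).1 hz with ⟨h, e, hq⟩ | ⟨h, e, hq⟩
      · exact .inl ⟨p z, h, hq, e ▸ H⟩
      · exact .inr (.inl ⟨q z, h, hq, e ▸ H⟩)
    · rw [hC.white] at hg
      exact .inr (.inr ⟨i, hi, hg.1, hg.2, H⟩)
  have h₁ : q w ∉ B.gray → ∀ x', A.Adj (p w) x' → Reply A B x' (q w) k := by
    intro hq x' hx'
    obtain ⟨v, rfl, e, hadj⟩ := hC.exists_left hq hx'
    exact e ▸ hreply v k (.adj hadj k)
  have h₂ : p w ∉ A.gray → ∀ y', B.Adj (q w) y' → Reply A B (p w) y' k := by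
    intro hp y' hy'
    obtain ⟨v, rfl, e, hadj⟩ := hC.symm.exists_left hp hy'
    exact e ▸ hreply v k (.adj hadj k)
  refine ⟨fun hp hq => ?_, fun hq => half_of_replies hq (h₁ hq),
    fun hp => half_of_replies hp fun y' h => (h₂ hp y' h).symm⟩
  have hf : ¬ (A.final (p w) = .fullMoon ∨ B.final (q w) = .fullMoon) := by
    rw [← hC.fullMoon_iff (hC.white.2 ⟨hp, hq⟩)]
    exact fun h => hl.not_win (win_of_fullMoon h k)
  rw [not_or] at hf
  exact numbers_of_replies hp hq hf.1 hf.2 (h₁ hq) (h₂ hp) fun j hj =>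
    hreply w j (.inr ⟨rfl, hC.white.2 ⟨hp, hq⟩, hj⟩)

/-- A white node of a sum that loses at `k` comes from two numbers of nim-sum `k`. -/
theorem IsCart.numbers_of_lose (hC : IsCart A B C p q) {w : W} {k : ℕ} (h : C.Lose w k)
    (hw : w ∉ C.gray) : Numbers A B (p w) (q w) k :=
  (hC.good_of_lose h).white (hC.white.1 hw).1 (hC.white.1 hw).2

end

/-- The algorithm finds every losing position. -/
theorem nim_of_lose [Finite V] {A : CarryOnDigraph V} {x : V} {k : ℕ} (h : A.Lose x k)
    (hx : x ∉ A.gray) : A.final x = .nim k := by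
  obtain ⟨n, m, hn, hm, rfl⟩ := A.isCart_point.numbers_of_lose h hx
  have : point.final () = .nim 0 := final_white_terminal (Set.notMem_empty _) fun _ h => h
  cases this.symm.trans hm
  rw [Nat.xor_zero]
  exact hn


/-! ### Numbers of a sum -/

section
variable {A : CarryOnDigraph V} {B : CarryOnDigraph U} {C : CarryOnDigraph W} {p : W → V}
  {q : W → U}

/-- A winning reply in the first summand next to its own heap wins in the sum: if the reply touches
the heap only, two different heaps next to the same white node cannot both be losing. -/
theorem IsCart.win_of_move (hC : IsCart A B C p q) {v : W} (hq : q v ∉ B.gray) {n m i : ℕ}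
    {x : V} (hm : A.Move (p v) n x i)
    (h : ∀ z, p z = x → q z = q v → C.Lose z (i ^^^ m)) : C.Win v (n ^^^ m) := by
  rcases hm with ⟨hx, rfl⟩ | ⟨rfl, hp, hi⟩
  · obtain ⟨z, hz, hz', hadj⟩ := hC.exists_left hq hx
    exact ⟨z, _, .adj hadj _, h z hz hz'⟩
  · exact (h v rfl rfl).win_of_ne (hC.white.2 ⟨hp, hq⟩) fun e => hi.ne' (Nat.xor_left_inj.1 e)

/-- The sum of losing positions is losing, with the nim-sum of the heaps as heap. -/
theorem IsCart.lose_xor (hC : IsCart A B C p q) {x : V} {y : U} {n m : ℕ} (hA : A.Lose x n)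
    (hB : B.Lose y m) : ∀ w, p w = x → q w = y → C.Lose w (n ^^^ m) := by
  revert y m
  refine Lose.induct (motive := fun x n => ∀ {y : U} {m : ℕ}, B.Lose y m →
    ∀ w, p w = x → q w = y → C.Lose w (n ^^^ m)) ?_ hA
  clear hA x n
  intro x n hA ihA y m hB
  refine Lose.induct (motive := fun y m => ∀ w, p w = x → q w = y → C.Lose w (n ^^^ m)) ?_ hB
  clear hB y m
  rintro y m hB ihB w rfl rfl
  refine lose_iff.2 ?_
  rintro v j (⟨hv, rfl⟩ | ⟨rfl, hg, hj⟩)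
  · rcases (hC.adj _ _).1 hv with ⟨h, e, hq⟩ | ⟨h, e, hp⟩
    · obtain ⟨x', i, hm, -, H⟩ := ihA (p v) n (.adj h n)
      exact hC.win_of_move (e ▸ hq) hm fun z hz hz' => H hB z hz (hz'.trans e.symm)
    · obtain ⟨y', i, hm, -, H⟩ := ihB (q v) m (.adj h m)
      rw [Nat.xor_comm]
      refine hC.symm.win_of_move (e ▸ hp) hm fun z hz hz' => ?_
      rw [Nat.xor_comm]
      exact H z (hz'.trans e.symm) hz
  · have hw := hC.white.1 hg
    rcases Nat.lt_xor_cases hj with h | h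
    · obtain ⟨x', i, hm, -, H⟩ := ihA (p v) _ (.inr ⟨rfl, hw.1, h⟩)
      have := hC.win_of_move hw.2 hm fun z hz hz' => H hB z hz hz'
      rwa [Nat.xor_assoc, Nat.xor_self, Nat.xor_zero] at this
    · obtain ⟨y', i, hm, -, H⟩ := ihB (q v) _ (.inr ⟨rfl, hw.2, h⟩)
      have := hC.symm.win_of_move (m := n) hw.1 hm fun z hz hz' => by
        rw [Nat.xor_comm]
        exact H z hz' hz
      rwa [Nat.xor_assoc, Nat.xor_self, Nat.xor_zero] at this

variable [Finite V] [Finite U]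

theorem IsCart.final_nim (hC : IsCart A B C p q) {w : W} {n m : ℕ}
    (hn : A.final (p w) = .nim n) (hm : B.final (q w) = .nim m) :
    C.final w = .nim (n ^^^ m) := by
  have := hC.finite
  exact nim_of_lose (hC.lose_xor (lose_of_nim hn) (lose_of_nim hm) w rfl rfl)
    (hC.white.2 ⟨white_of_nim hn, white_of_nim hm⟩)

theorem IsCart.numbers_of_nim (hC : IsCart A B C p q) {w : W} {k : ℕ}
    (h : C.final w = .nim k) : Numbers A B (p w) (q w) k := by
  have := hC.finite
  exact hC.numbers_of_lose (lose_of_nim h) (white_of_nim h)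

end

/-! ### Kept values -/

/-- The numbers labelling the white nodes that can be reached from `x` by keeping the opponent on
forced runs. It differs from the set of forcing values only in that the node `x` itself counts, so
that it is `{n}` for a node labelled `n`. -/
def keptValues (A : CarryOnDigraph V) (x : V) : Set ℕ :=
  {k | ∃ e, Relation.ReflTransGen A.Keep x e ∧ A.final e = .nim k}

section
variable {A : CarryOnDigraph V}

theorem keptValues_subset_of_keep {x e : V} (h : A.Keep x e) :
    A.keptValues e ⊆ A.keptValues x :=
  fun _ ⟨e', h', he⟩ => ⟨e', .head h h', he⟩

theorem mem_keptValues_of_nim {x : V} {n : ℕ} (h : A.final x = .nim n) : n ∈ A.keptValues x :=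
  ⟨x, .refl, h⟩

/-- The outcome of a forced run is that of its end, up to the parity of the run. -/
theorem Chain.lose_or_win {e g : V} {b : Bool} (h : A.Chain e b g) {k : ℕ}
    (hk : if b then A.Win g k else A.Lose g k) : A.Lose e k := by
  induction h with
  | last hg h _ => exact (win_gray_iff hg h).1 hk
  | @cons g g' b hg h _ ih =>
    cases b
    · exact ih ((win_gray_iff hg h).1 hk)
    · exact ih ((lose_gray_iff hg h).1 hk)

theorem IsForcing.exists_keep {x : V} {k : ℕ} (h : A.IsForcing k x) :
    ∃ e, A.Keep x e ∧ k ∈ A.keptValues e := by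
  induction h with
  | white h₁ hg h₂ hz hk => exact ⟨_, ⟨_, h₁, .last hg h₂ hz⟩, mem_keptValues_of_nim hk⟩
  | @step x y z h₁ hg h₂ _ ih =>
    obtain ⟨e, he, hk⟩ := ih
    by_cases hz : z ∈ A.gray
    · obtain ⟨g, hzg, hc⟩ := he
      exact ⟨e, ⟨y, h₁, .cons hg h₂ (.cons hz hzg hc)⟩, hk⟩
    · exact ⟨z, ⟨y, h₁, .last hg h₂ hz⟩, keptValues_subset_of_keep he hk⟩

theorem Chain.isForcing {e g : V} {b : Bool} (h : A.Chain e b g) {k : ℕ}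
    (hk : A.final e = .nim k ∨ A.IsForcing k e) :
    if b then ∀ x, A.Adj x g → A.IsForcing k x else A.IsForcing k g := by
  induction h with
  | last hg h hw =>
    intro x hx
    rcases hk with hk | hk
    · exact .white hx hg h hw hk
    · exact .step hx hg h hk
  | @cons g g' b hg h _ ih =>
    cases b
    · exact fun x hx => .step hx hg h ih
    · exact ih g h

theorem isForcing_of_keep {x e : V} {k : ℕ} (h : A.Keep x e) (hk : k ∈ A.keptValues e) :
    A.IsForcing k x := by
  obtain ⟨f, hf, hk⟩ := hk
  induction hf using Relation.ReflTransGen.head_induction_on generalizing x with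
  | refl =>
    obtain ⟨g, hg, hc⟩ := h
    exact hc.isForcing (.inl hk) x hg
  | head h' _ ih =>
    obtain ⟨g, hg, hc⟩ := h
    exact hc.isForcing (.inr (ih h')) x hg

theorem forcingValues_eq {x : V} (h : ∀ n, A.final x ≠ .nim n) :
    A.forcingValues x = A.keptValues x := by
  ext k
  constructor
  · intro hk
    obtain ⟨e, he, hk⟩ := IsForcing.exists_keep hk
    exact keptValues_subset_of_keep he hk
  · rintro ⟨f, hf, hk⟩
    rcases hf.cases_head with rfl | ⟨e, he, hf⟩
    · exact absurd hk (h k)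
    · exact isForcing_of_keep he ⟨f, hf, hk⟩

/-- A moon is due to an earlier stage at which all numbers were excluded. -/
theorem stage_moon {t : ℕ} {x : V} (hx : x ∉ A.gray) (h : A.stage t x = .moon) :
    ∃ u < t, A.excluded (A.stage u) x = Set.univ := by
  induction t with
  | zero =>
    change A.initial x = _ at h
    unfold initial at h
    split_ifs at h
  | succ t ih =>
    rcases step_white (s := A.stage t) hx with ⟨-, e⟩ | ⟨-, ⟨hE, -⟩ | ⟨-, ⟨-, e⟩ | ⟨-, e⟩⟩⟩
    · cases e.symm.trans h
    · exact ⟨t, Nat.lt_succ_self t, hE⟩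
    · cases e.symm.trans h
    · obtain ⟨u, hu, hE⟩ := ih (e.symm.trans h)
      exact ⟨u, hu.trans (Nat.lt_succ_self t), hE⟩

variable [Finite V]

/-- Keeping the initiative from a node labelled `n` leads to nodes labelled `n` only. -/
theorem Keep.final_nim {x e : V} (h : A.Keep x e) {n : ℕ} (hx : A.final x = .nim n) :
    A.final e = .nim n := by
  obtain ⟨g, hg, hc⟩ := h
  exact nim_of_lose (hc.lose_or_win (lose_iff.1 (lose_of_nim hx) g n (.adj hg n))) hc.white

theorem keptValues_of_nim {x : V} {n : ℕ} (hx : A.final x = .nim n) :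
    A.keptValues x = {n} := by
  ext k
  constructor
  · rintro ⟨e, he, hk⟩
    have : A.final e = .nim n := by
      clear hk
      induction he with
      | refl => exact hx
      | tail _ h ih => exact h.final_nim ih
    cases this.symm.trans hk
    rfl
  · rintro rfl
    exact mem_keptValues_of_nim hx

theorem keptValues_nonempty_of_stage (t : ℕ) {x : V} (hx : x ∉ A.gray)
    (hf : A.final x ≠ .fullMoon) (h : A.stage t x = .moon) : (A.keptValues x).Nonempty := by
  induction t using Nat.strong_induction_on generalizing x with
  | h t ih =>
    obtain ⟨u, hu, hE⟩ := stage_moon hx h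
    -- A number `j` that labels no node can only be excluded by keeping the initiative.
    obtain ⟨j, hj⟩ := A.exists_fresh
    rcases exists_end_of_mem_excluded (hE ▸ trivial : j ∈ A.excluded (A.stage u) x) with
      ⟨e, -, he⟩ | ⟨e, he, v, hv, ⟨i, -, hi⟩ | hm⟩
    · exact absurd (final_nim_of_stage he) (hj e)
    · exact ⟨i, keptValues_subset_of_keep he (mem_keptValues_of_nim (final_nim_of_stage hi))⟩
    · exact (ih v (hv.trans hu) he.white (fun e' => hf (he.final_fullMoon e' hx)) hm).mono
        (keptValues_subset_of_keep he)

theorem keptValues_nonempty_of_moon {x : V} (h : A.final x = .moon) :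
    (A.keptValues x).Nonempty := by
  obtain ⟨T, e, -⟩ := A.exists_final_eq_stage
  have hx := A.sem_final x
  rw [h] at hx
  exact keptValues_nonempty_of_stage T hx.1 (by simp [h]) (by rw [← e, h])

end

/-! ### Moons of a sum -/

section
variable {A : CarryOnDigraph V} {B : CarryOnDigraph U} {C : CarryOnDigraph W} {p : W → V}
  {q : W → U}

theorem IsCart.reflTransGen_keep (hC : IsCart A B C p q) {x e : V}
    (h : Relation.ReflTransGen A.Keep x e) {w w' : W} (hq : q w ∉ B.gray) (hq' : q w' = q w)
    (hx : p w = x) (he : p w' = e) : Relation.ReflTransGen C.Keep w w' := by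
  induction h using Relation.ReflTransGen.head_induction_on generalizing w with
  | refl => rw [hC.inj w w' (hx.trans he.symm) hq'.symm]
  | @head x x' h _ ih =>
    obtain ⟨v, hv, hv'⟩ := hC.surj x' (q w) fun h => hq h.2
    refine .head (hC.keep hq hv' (by rwa [hx, hv])) (ih ?_ ?_ hv)
    · rwa [hv']
    · rw [hq', hv']

theorem IsCart.reflTransGen_keep_inv (hC : IsCart A B C p q) {w w' : W}
    (h : Relation.ReflTransGen C.Keep w w') :
    Relation.ReflTransGen A.Keep (p w) (p w') ∧ Relation.ReflTransGen B.Keep (q w) (q w') := by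
  induction h with
  | refl => exact ⟨.refl, .refl⟩
  | tail _ h ih =>
    rcases hC.keep_inv h with ⟨e, h⟩ | ⟨e, h⟩
    · exact ⟨ih.1.tail h, e ▸ ih.2⟩
    · exact ⟨e ▸ ih.1, ih.2.tail h⟩

variable [Finite V] [Finite U]

theorem IsCart.keptValues (hC : IsCart A B C p q) {w : W} (hw : w ∉ C.gray) :
    C.keptValues w = nimSum (A.keptValues (p w)) (B.keptValues (q w)) := by
  rw [hC.white] at hw
  ext k
  constructor
  · rintro ⟨w', h, hk⟩
    obtain ⟨n, m, hn, hm, rfl⟩ := hC.numbers_of_nim hk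
    have h' := hC.reflTransGen_keep_inv h
    exact ⟨n, ⟨_, h'.1, hn⟩, m, ⟨_, h'.2, hm⟩, rfl⟩
  · rintro ⟨n, ⟨x, hx, hn⟩, m, ⟨y, hy, hm⟩, rfl⟩
    have hxg := white_of_nim hn
    obtain ⟨v, rfl, hv⟩ := hC.surj x (q w) fun h => hxg h.1
    obtain ⟨w', hw', rfl⟩ := hC.surj (p v) y fun h => hxg h.1
    refine ⟨w', (hC.reflTransGen_keep hx hw.2 hv rfl rfl).trans
      (hC.symm.reflTransGen_keep hy hxg hw' hv rfl), ?_⟩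
    exact hC.final_nim (hw' ▸ hn) hm

/-- The sum of a moon and a number is a moon. -/
theorem IsCart.moon_of_stage_of_nim (hC : IsCart A B C p q) (t : ℕ) {w : W}
    (hp : p w ∉ A.gray) (hf : A.final (p w) ≠ .fullMoon) (h : A.stage t (p w) = .moon) {m : ℕ}
    (hm : B.final (q w) = .nim m) : C.final w = .moon := by
  have := hC.finite
  induction t using Nat.strong_induction_on generalizing w with
  | h t ih =>
    have hq := white_of_nim hm
    have hw := hC.white.2 ⟨hp, hq⟩
    refine moon_of_excluded_eq_univ hw ?_ (Set.eq_univ_of_forall fun k => ?_)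
    · rw [Ne, hC.fullMoon_iff hw, hm]
      simpa using hf
    obtain ⟨u, hu, hE⟩ := stage_moon hp h
    have hk : k ^^^ m ^^^ m = k := by rw [Nat.xor_assoc, Nat.xor_self, Nat.xor_zero]
    rcases exists_end_of_mem_excluded (hE ▸ trivial : k ^^^ m ∈ A.excluded (A.stage u) (p w)) with
      ⟨e, he, hn⟩ | ⟨e, he, v, hv, ⟨i, hi, hn⟩ | hn⟩
    · obtain ⟨w', rfl, hw'⟩ := hC.surj e (q w) fun h => hq h.2
      refine (hC.pass hq hw' he).mem_excluded ?_
      rw [hC.final_nim (final_nim_of_stage hn) (hw' ▸ hm), hk]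
    · obtain ⟨w', rfl, hw'⟩ := hC.surj e (q w) fun h => hq h.2
      refine (hC.keep hq hw' he).mem_excluded_of_nim
        (hC.final_nim (final_nim_of_stage hn) (hw' ▸ hm)) ?_
      rw [← hk]
      exact fun h => hi (Nat.xor_left_inj.1 h).symm
    · obtain ⟨w', rfl, hw'⟩ := hC.surj e (q w) fun h => hq h.2
      refine (hC.keep hq hw' he).mem_excluded_of_moon (ih v (hv.trans hu) he.white ?_ hn
        (hw' ▸ hm)) k
      exact fun e' => hf (he.final_fullMoon e' hp)

/-- The sum of a moon and of a game from which a number can be forced is a moon. -/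
theorem IsCart.moon_of_moon (hC : IsCart A B C p q) {w : W} (hA : A.final (p w) = .moon)
    (hq : q w ∉ B.gray) (hf : B.final (q w) ≠ .fullMoon) (hB : (B.keptValues (q w)).Nonempty) :
    C.final w = .moon := by
  have := hC.finite
  have hp : p w ∉ A.gray := by
    have := A.sem_final (p w)
    rw [hA] at this
    exact this.1
  obtain ⟨T, eT, -⟩ := A.exists_final_eq_stage
  obtain ⟨m, y, hy, hm⟩ := hB
  generalize hqw : q w = y' at hy
  induction hy using Relation.ReflTransGen.head_induction_on generalizing w with
  | refl => exact hC.moon_of_stage_of_nim T hp (by simp [hA]) (by rw [← eT, hA]) (hqw ▸ hm)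
  | @head y₀ y₁ h _ ih =>
    subst hqw
    have hw := hC.white.2 ⟨hp, hq⟩
    obtain ⟨w', hw', rfl⟩ := hC.surj (p w) y₁ fun h => hp h.1
    refine (hC.symm.keep hp hw' h).final_moon (ih (hw' ▸ hA) h.white ?_ (hw' ▸ hp) rfl) hw ?_
    · exact fun e => hf (h.final_fullMoon e hq)
    · rw [Ne, hC.fullMoon_iff hw, hA]
      simpa using hf

/-- If all numbers are excluded at `w` and the second summand is a number `m`, then the first one is
a moon: otherwise, a number `a` that is not excluded there makes `a ^^^ m` not excluded at `w`. -/
theorem IsCart.moon_left_of_univ (hC : IsCart A B C p q) {w : W} (hw : w ∉ C.gray) {u : ℕ}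
    (hE : C.excluded (C.stage u) w = Set.univ)
    (ih : ∀ v < u, ∀ w', C.Keep w w' → C.stage v w' = .moon →
      A.final (p w') = .moon ∨ B.final (q w') = .moon)
    (hA : ∀ n, A.final (p w) ≠ .nim n) (hf : A.final (p w) ≠ .fullMoon) {m : ℕ}
    (hm : B.final (q w) = .nim m) : A.final (p w) = .moon := by
  have := hC.finite
  by_contra hA'
  have hp := (hC.white.1 hw).1
  have ha : mex (A.excluded A.final (p w)) ∉ _ :=
    mex_notMem fun h => hA' (moon_of_excluded_eq_univ hp hf h)
  generalize mex (A.excluded A.final (p w)) = a at ha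
  rcases exists_end_of_mem_excluded (hE ▸ trivial : a ^^^ m ∈ C.excluded (C.stage u) w) with
    ⟨e, he, hs⟩ | ⟨e, he, v, hv, ⟨i, hi, hs⟩ | hs⟩
  · obtain ⟨n, m', hn, hm', h⟩ := hC.numbers_of_nim (final_nim_of_stage hs)
    rcases hC.pass_inv he with ⟨e', he⟩ | ⟨e', he⟩
    · rw [e'] at hm'
      cases hm.symm.trans hm'
      obtain rfl := Nat.xor_left_inj.1 h
      exact ha (he.mem_excluded hn)
    · exact hA n (e' ▸ hn)
  · obtain ⟨n, m', hn, hm', rfl⟩ := hC.numbers_of_nim (final_nim_of_stage hs)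
    rcases hC.keep_inv he with ⟨e', he⟩ | ⟨e', he⟩
    · rw [e'] at hm'
      cases hm.symm.trans hm'
      refine ha (he.mem_excluded_of_nim hn ?_)
      rintro rfl
      exact hi rfl
    · exact hA n (e' ▸ hn)
  · have hih := ih v hv e he hs
    rcases hC.keep_inv he with ⟨e', he⟩ | ⟨e', he⟩
    · rw [e', hm] at hih
      exact ha (he.mem_excluded_of_moon (hih.resolve_right (by simp)) a)
    · rw [e', he.final_nim hm] at hih
      exact hA' (hih.resolve_right (by simp))

/-- A moon of a sum needs a moon as a summand, and kept values in both summands. -/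
theorem IsCart.moon_of_stage (hC : IsCart A B C p q) (t : ℕ) {w : W} (hw : w ∉ C.gray)
    (hf : C.final w ≠ .fullMoon) (h : C.stage t w = .moon) :
    (A.final (p w) = .moon ∨ B.final (q w) = .moon) ∧ (A.keptValues (p w)).Nonempty ∧
      (B.keptValues (q w)).Nonempty := by
  have := hC.finite
  induction t using Nat.strong_induction_on generalizing w with
  | h t ih =>
    have hw' := hC.white.1 hw
    have hfAB := hf
    rw [Ne, hC.fullMoon_iff hw, not_or] at hfAB
    obtain ⟨u, hu, hE⟩ := stage_moon hw h
    have ih' : ∀ v < u, ∀ w', C.Keep w w' → C.stage v w' = .moon →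
        (A.final (p w') = .moon ∨ B.final (q w') = .moon) ∧ (A.keptValues (p w')).Nonempty ∧
          (B.keptValues (q w')).Nonempty := fun v hv w' hk hm =>
      ih v (hv.trans hu) hk.white (fun e => hf (hk.final_fullMoon e hw)) hm
    have hnum : ∀ {n m}, A.final (p w) = .nim n → B.final (q w) ≠ .nim m := by
      intro n m hn hm
      have := hC.final_nim hn hm
      rcases final_moon_of_stage h with e | e <;> cases e.symm.trans this
    by_cases hA : ∃ n, A.final (p w) = .nim n
    · obtain ⟨n, hn⟩ := hA
      have hB := hC.symm.moon_left_of_univ hw hE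
        (fun v hv w' hk hm => (ih' v hv w' hk hm).1.symm) (fun m => hnum hn) hfAB.2 hn
      exact ⟨.inr hB, ⟨n, mem_keptValues_of_nim hn⟩, keptValues_nonempty_of_moon hB⟩
    · by_cases hB : ∃ m, B.final (q w) = .nim m
      · obtain ⟨m, hm⟩ := hB
        have hA := hC.moon_left_of_univ hw hE
          (fun v hv w' hk hm => (ih' v hv w' hk hm).1) (fun n hn => hA ⟨n, hn⟩) hfAB.1 hm
        exact ⟨.inl hA, keptValues_nonempty_of_moon hA, ⟨m, mem_keptValues_of_nim hm⟩⟩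
      · -- The exclusion of a number `j` that labels no node is due to a move that keeps the
        -- initiative; without numbers among the summands, it leads to an earlier moon.
        obtain ⟨j, hj⟩ := C.exists_fresh
        rcases exists_end_of_mem_excluded (hE ▸ trivial : j ∈ C.excluded (C.stage u) w) with
          ⟨e, -, he⟩ | ⟨e, he, v, hv, ⟨i, -, hi⟩ | hm⟩
        · exact absurd (final_nim_of_stage he) (hj e)
        · obtain ⟨n, m, hn, hm, -⟩ := hC.numbers_of_nim (final_nim_of_stage hi)
          rcases hC.keep_inv he with ⟨e', -⟩ | ⟨e', -⟩
          · exact absurd ⟨m, e' ▸ hm⟩ hB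
          · exact absurd ⟨n, e' ▸ hn⟩ hA
        · obtain ⟨h₁, h₂, h₃⟩ := ih' v hv e he hm
          rcases hC.keep_inv he with ⟨e', he⟩ | ⟨e', he⟩
          · rw [e'] at h₁ h₃
            exact ⟨h₁.imp_left fun h => he.final_moon h hw'.1 hfAB.1,
              h₂.mono (keptValues_subset_of_keep he), h₃⟩
          · rw [e'] at h₁ h₂
            exact ⟨h₁.imp_right fun h => he.final_moon h hw'.2 hfAB.2, h₂,
              h₃.mono (keptValues_subset_of_keep he)⟩

theorem IsCart.moon_iff (hC : IsCart A B C p q) {w : W} (hw : w ∉ C.gray)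
    (hf : C.final w ≠ .fullMoon) :
    C.final w = .moon ↔ (A.final (p w) = .moon ∨ B.final (q w) = .moon) ∧
      (A.keptValues (p w)).Nonempty ∧ (B.keptValues (q w)).Nonempty := by
  have := hC.finite
  constructor
  · intro h
    obtain ⟨T, e, -⟩ := C.exists_final_eq_stage
    exact hC.moon_of_stage T hw hf (by rw [← e, h])
  · rintro ⟨h, hA, hB⟩
    rw [Ne, hC.fullMoon_iff hw, not_or] at hf
    rw [hC.white] at hw
    rcases h with h | h
    · exact hC.moon_of_moon h hw.2 hf.2 hB
    · exact hC.symm.moon_of_moon h hw.1 hf.1 hA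

end

/-! ### Direct values of a sum -/

section
variable {A : CarryOnDigraph V}

/-- Away from full moons, a direct value is a number that can be passed after keeping the
initiative. -/
theorem IsDirect.exists_pass [Finite V] {k : ℕ} {x : V} (h : A.IsDirect k x)
    (hf : A.final x ≠ .fullMoon) :
    ∃ y, Relation.ReflTransGen A.Keep x y ∧ ∃ e, A.Pass y e ∧ A.final e = .nim k := by
  induction h with
  | white h hg hk => exact ⟨_, .refl, _, .inl ⟨h, hg⟩, hk⟩
  | @gray x y hxy hg _ ih =>
    have hy : A.final y ≠ .newMoon := by
      intro hy
      by_cases hx : x ∈ A.gray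
      · exact hf (by rw [final_gray hx hxy, hy]; rfl)
      · exact hf ((final_fullMoon_iff hx).2 ⟨y, hxy, hg, hy⟩)
    by_cases hex : ∃ z, A.Adj y z
    · obtain ⟨z, hz⟩ := hex
      obtain ⟨v, hv, e, he, hk⟩ := ih z hz fun h => hy (by rw [final_gray hg hz, h]; rfl)
      by_cases hzg : z ∈ A.gray
      · rcases hv.cases_head with rfl | ⟨z', ⟨g, hzg', hc⟩, hv⟩
        · refine ⟨x, .refl, e, .inr ⟨y, hxy, ?_⟩, hk⟩
          rcases he with ⟨h, he⟩ | ⟨g, hzg', hc⟩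
          · exact .cons hg hz (.last hzg h he)
          · exact .cons hg hz (.cons hzg hzg' hc)
        · exact ⟨v, .head ⟨y, hxy, .cons hg hz (.cons hzg hzg' hc)⟩ hv, e, he, hk⟩
      · exact ⟨v, .head ⟨y, hxy, .last hg hz hzg⟩ hv, e, he, hk⟩
    · exact absurd (final_gray_terminal hg (by simpa using hex)) hy

theorem Chain.isDirect_of_nim {e g : V} {b : Bool} (h : A.Chain e b g) {k : ℕ}
    (hk : A.final e = .nim k) :
    if b then A.IsDirect k g else ∀ z, A.Adj g z → A.IsDirect k z := by
  induction h with
  | last _ h hw => exact .white h hw hk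
  | @cons g g' b hg h c ih =>
    cases b
    · exact .gray h c.gray ih
    · intro z hz
      rw [A.gray_outdegree_le_one g hg z g' hz h]
      exact ih

theorem Chain.isDirect {e g : V} {b : Bool} (h : A.Chain e b g) {k : ℕ}
    (hk : A.IsDirect k e) :
    if b then ∀ z, A.Adj g z → A.IsDirect k z else A.IsDirect k g := by
  induction h with
  | last hg h hw =>
    intro z hz
    rwa [A.gray_outdegree_le_one _ hg z e hz h]
  | @cons g g' b hg h c ih =>
    cases b
    · intro z hz
      rw [A.gray_outdegree_le_one g hg z g' hz h]
      exact ih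
    · exact .gray h c.gray ih

theorem isDirect_of_pass {k : ℕ} {x y e : V} (h : Relation.ReflTransGen A.Keep x y)
    (he : A.Pass y e) (hk : A.final e = .nim k) : A.IsDirect k x := by
  induction h using Relation.ReflTransGen.head_induction_on with
  | refl =>
    rcases he with ⟨h, hg⟩ | ⟨g, hg, hc⟩
    · exact .white h hg hk
    · exact .gray hg hc.gray (hc.isDirect_of_nim hk)
  | head h _ ih =>
    obtain ⟨g, hg, hc⟩ := h
    exact .gray hg hc.gray (hc.isDirect ih)

variable {B : CarryOnDigraph U} {C : CarryOnDigraph W} {p : W → V} {q : W → U}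
  [Finite V] [Finite U]

/-- If the second summand has no kept values, the number that is passed in the end is passed in the
second summand, while a kept value of the first one waits. -/
theorem IsCart.directValues (hC : IsCart A B C p q) {w : W} (hw : w ∉ C.gray)
    (hf : C.final w ≠ .fullMoon) (hB : B.keptValues (q w) = ∅) :
    C.directValues w = nimSum (A.keptValues (p w)) (B.directValues (q w)) := by
  have := hC.finite
  ext k
  constructor
  · intro hk
    obtain ⟨v, hv, e, he, hk⟩ := IsDirect.exists_pass hk hf
    obtain ⟨n, m, hn, hm, rfl⟩ := hC.numbers_of_nim hk
    have hv' := hC.reflTransGen_keep_inv hv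
    rcases hC.pass_inv he with ⟨e', he⟩ | ⟨e', he⟩
    · exact (Set.eq_empty_iff_forall_notMem.1 hB m ⟨_, hv'.2, e' ▸ hm⟩).elim
    · exact ⟨n, ⟨_, hv'.1, e' ▸ hn⟩, m, isDirect_of_pass hv'.2 he hm, rfl⟩
  · rintro ⟨n, ⟨x, hx, hn⟩, m, hm, rfl⟩
    have hxg := white_of_nim hn
    rw [Ne, hC.fullMoon_iff hw, not_or] at hf
    rw [hC.white] at hw
    obtain ⟨y, hy, e, he, hm⟩ := IsDirect.exists_pass hm hf.2
    obtain ⟨v, rfl, hv⟩ := hC.surj x (q w) fun h => hxg h.1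
    obtain ⟨w', hw', rfl⟩ := hC.surj (p v) y fun h => hxg h.1
    obtain ⟨z, hz, rfl⟩ := hC.surj (p v) e fun h => hxg h.1
    refine isDirect_of_pass (y := w') (e := z) ?_ (hC.symm.pass (hw' ▸ hxg) ?_ he) ?_
    · exact (hC.reflTransGen_keep hx hw.2 hv rfl rfl).trans
        (hC.symm.reflTransGen_keep hy hxg hw' hv rfl)
    · rw [hz, hw']
    · exact hC.final_nim (hz ▸ hn) hm

end


/-! ### The addition table -/

theorem nimSum_comm (S T : Set ℕ) : nimSum S T = nimSum T S := by
  unfold nimSum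
  rw [Set.image2_swap]
  simp only [Nat.xor_comm]

theorem nimSum_empty (S : Set ℕ) : nimSum S ∅ = ∅ := Set.image2_empty_right

theorem nimSum_singleton_left (n : ℕ) (S : Set ℕ) : nimSum {n} S = nimShift n S :=
  Set.image2_singleton_left

theorem nimSum_singleton_right (S : Set ℕ) (n : ℕ) : nimSum S {n} = nimShift n S := by
  rw [nimSum_comm, nimSum_singleton_left]

theorem nimShift_singleton (n m : ℕ) : nimShift n {m} = {n ^^^ m} := Set.image_singleton

theorem eq_singleton_of_nimSum {S T : Set ℕ} {k : ℕ} (h : nimSum S T = {k}) :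
    ∃ n m, S = {n} ∧ T = {m} := by
  obtain ⟨n, hn, m, hm, e⟩ : k ∈ nimSum S T := h ▸ Set.mem_singleton k
  have hk : ∀ a ∈ S, ∀ b ∈ T, a ^^^ b = n ^^^ m := fun a ha b hb =>
    (h ▸ Set.mem_image2_of_mem ha hb : a ^^^ b ∈ ({k} : Set ℕ)).trans e.symm
  exact ⟨n, m, Set.eq_singleton_iff_unique_mem.2
    ⟨hn, fun a ha => Nat.xor_left_inj.1 (hk a ha m hm)⟩, Set.eq_singleton_iff_unique_mem.2
    ⟨hm, fun b hb => Nat.xor_right_inj.1 (hk n hn b hb)⟩⟩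

/-- The final data of the white node `x`, its Grundy value and whether the algorithm returns it.
For an unassigned node, `infinity`, `nymphet` and `hiddenMoon` are the cases of none, one and at
least two kept values. -/
inductive Profile (A : CarryOnDigraph V) (x : V) : Value → Option Value → Prop
  | fullMoon : A.final x = .fullMoon → Profile A x .fullMoon (some .fullMoon)
  | nim (n : ℕ) : A.final x = .nim n → A.keptValues x = {n} → Profile A x (.nim n) (some (.nim n))
  | moon : A.final x = .moon → (A.keptValues x).Nonempty →
      Profile A x (.moon (A.keptValues x)) (some (.moon (A.keptValues x)))
  | infinity : A.final x = .unassigned → A.keptValues x = ∅ →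
      Profile A x (.infinity (A.directValues x)) (some (.infinity (A.directValues x)))
  | nymphet (f : ℕ) : A.final x = .unassigned → A.keptValues x = {f} →
      Profile A x (.nymphet f) (some (.nymphet f))
  | hiddenMoon : A.final x = .unassigned → (A.keptValues x).Nonempty →
      (∀ f, A.keptValues x ≠ {f}) → Profile A x (.moon (A.keptValues x)) none

section
variable {A : CarryOnDigraph V} {x : V}

theorem Profile.output_eq {v : Value} {o : Option Value} (h : A.Profile x v o) :
    A.output x = o ∧ A.grundy x = v := by
  have key : A.output x = o → (∀ v', o = some v' → v' = v) →
      (o = none → v = .moon (A.forcingValues x)) → A.output x = o ∧ A.grundy x = v := by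
    intro h₁ h₂ h₃
    refine ⟨h₁, ?_⟩
    rw [grundy, h₁]
    cases o with
    | none => exact (h₃ rfl).symm
    | some v' => exact h₂ v' rfl
  have hF : A.final x = .unassigned ∨ A.final x = .moon → A.forcingValues x = A.keptValues x :=
    fun h => forcingValues_eq fun n hn => by rcases h with h | h <;> cases h.symm.trans hn
  cases h with
  | fullMoon h => exact key (by simp [output, h]) (by simp) (by simp)
  | nim n h => exact key (by simp [output, h]) (by simp) (by simp)
  | moon h => exact key (by simp [output, h, hF (.inr h)]) (by simp) (by simp)
  | infinity h h' =>
    refine key ?_ (by simp) (by simp)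
    have h₁ : ¬ ∃ f, A.forcingValues x = {f} := by
      rw [hF (.inl h), h']
      rintro ⟨f, hf⟩
      exact Set.singleton_ne_empty f hf.symm
    simp only [output, h]
    rw [dif_neg h₁, if_pos ((hF (.inl h)).trans h')]
  | nymphet f h h' =>
    refine key ?_ (by simp) (by simp)
    have h₁ : ∃ f, A.forcingValues x = {f} := ⟨f, (hF (.inl h)).trans h'⟩
    simp only [output, h]
    rw [dif_pos h₁]
    rw [Set.singleton_injective (h₁.choose_spec.symm.trans ((hF (.inl h)).trans h'))]
  | hiddenMoon h h' h'' =>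
    refine key ?_ (by simp) (by simp [hF (.inl h)])
    have h₁ : ¬ ∃ f, A.forcingValues x = {f} := by
      rw [hF (.inl h)]
      rintro ⟨f, hf⟩
      exact h'' f hf
    have h₂ : A.forcingValues x ≠ ∅ := by
      rw [hF (.inl h)]
      exact h'.ne_empty
    simp only [output, h]
    rw [dif_neg h₁, if_neg h₂]

theorem exists_profile [Finite V] (hx : x ∉ A.gray) : ∃ v o, A.Profile x v o := by
  rcases final_white_cases hx with h | ⟨n, h⟩ | h | h
  · rcases (A.keptValues x).eq_empty_or_nonempty with h' | h'
    · exact ⟨_, _, .infinity h h'⟩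
    · by_cases hf : ∃ f, A.keptValues x = {f}
      · obtain ⟨f, hf⟩ := hf
        exact ⟨_, _, .nymphet f h hf⟩
      · exact ⟨_, _, .hiddenMoon h h' (by simpa using hf)⟩
  · exact ⟨_, _, .nim n h (keptValues_of_nim h)⟩
  · exact ⟨_, _, .moon h (keptValues_nonempty_of_moon h)⟩
  · exact ⟨_, _, .fullMoon h⟩

end

section
variable {A : CarryOnDigraph V} {B : CarryOnDigraph U} {C : CarryOnDigraph W} {p : W → V}
  {q : W → U} [Finite V] [Finite U]

theorem IsCart.final_unassigned (hC : IsCart A B C p q) {w : W} (hw : w ∉ C.gray)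
    (hf : C.final w ≠ .fullMoon)
    (hn : (∀ n, A.final (p w) ≠ .nim n) ∨ ∀ m, B.final (q w) ≠ .nim m)
    (hm : ¬ ((A.final (p w) = .moon ∨ B.final (q w) = .moon) ∧ (A.keptValues (p w)).Nonempty ∧
      (B.keptValues (q w)).Nonempty)) : C.final w = .unassigned := by
  have := hC.finite
  rcases final_white_cases hw with h | ⟨k, h⟩ | h | h
  · exact h
  · obtain ⟨n, m, h₁, h₂, -⟩ := hC.numbers_of_nim h
    rcases hn with hn | hn
    · exact absurd h₁ (hn n)
    · exact absurd h₂ (hn m)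
  · exact absurd ((hC.moon_iff hw hf).1 h) hm
  · exact absurd h hf

/-- A sum with a summand without kept values is an infinity. -/
theorem IsCart.profile_infinity (hC : IsCart A B C p q) {w : W} (hw : w ∉ C.gray)
    (hf : C.final w ≠ .fullMoon) (hB : B.keptValues (q w) = ∅) :
    C.Profile w (.infinity (nimSum (A.keptValues (p w)) (B.directValues (q w))))
      (some (.infinity (nimSum (A.keptValues (p w)) (B.directValues (q w))))) := by
  rw [← hC.directValues hw hf hB]
  refine .infinity (hC.final_unassigned hw hf (.inr fun m hm => ?_) fun h => ?_) ?_
  · exact (Set.eq_empty_iff_forall_notMem.1 hB m) (mem_keptValues_of_nim hm)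
  · exact h.2.2.ne_empty hB
  · rw [hC.keptValues hw, hB, nimSum_empty]

theorem IsCart.profile_moon (hC : IsCart A B C p q) {w : W} (hw : w ∉ C.gray)
    (hf : C.final w ≠ .fullMoon) (h : A.final (p w) = .moon ∨ B.final (q w) = .moon)
    (hA : (A.keptValues (p w)).Nonempty) (hB : (B.keptValues (q w)).Nonempty) :
    C.Profile w (.moon (nimSum (A.keptValues (p w)) (B.keptValues (q w))))
      (some (.moon (nimSum (A.keptValues (p w)) (B.keptValues (q w))))) := by
  rw [← hC.keptValues hw]
  refine .moon ((hC.moon_iff hw hf).2 ⟨h, hA, hB⟩) ?_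
  rw [hC.keptValues hw]
  exact hA.image2 hB

/-- If one of the summands has two kept values, so has the sum, which then counts as a moon whether
or not it is labelled as one. -/
theorem IsCart.profile_hiddenMoon (hC : IsCart A B C p q) {w : W} (hw : w ∉ C.gray)
    (hf : C.final w ≠ .fullMoon)
    (hA : (A.keptValues (p w)).Nonempty) (hB : (B.keptValues (q w)).Nonempty)
    (h : (∀ f, A.keptValues (p w) ≠ {f}) ∨ ∀ f, B.keptValues (q w) ≠ {f}) :
    ∃ o, C.Profile w (.moon (nimSum (A.keptValues (p w)) (B.keptValues (q w)))) o := by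
  have := hC.finite
  by_cases hm : A.final (p w) = .moon ∨ B.final (q w) = .moon
  · exact ⟨_, hC.profile_moon hw hf hm hA hB⟩
  · rw [← hC.keptValues hw]
    refine ⟨_, .hiddenMoon (hC.final_unassigned hw hf ?_ fun h => hm h.1) ?_ fun k hk => ?_⟩
    · rcases h with h | h
      · exact .inl fun n hn => h n (keptValues_of_nim hn)
      · exact .inr fun n hn => h n (keptValues_of_nim hn)
    · rw [hC.keptValues hw]
      exact hA.image2 hB
    · rw [hC.keptValues hw] at hk
      obtain ⟨n, m, hn, hm⟩ := eq_singleton_of_nimSum hk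
      rcases h with h | h
      · exact h n hn
      · exact h m hm

theorem IsCart.profile_nymphet (hC : IsCart A B C p q) {w : W} (hw : w ∉ C.gray)
    (hf : C.final w ≠ .fullMoon) {n m : ℕ}
    (hA : A.keptValues (p w) = {n}) (hB : B.keptValues (q w) = {m})
    (hn : (∀ n, A.final (p w) ≠ .nim n) ∨ ∀ m, B.final (q w) ≠ .nim m)
    (hm : ¬ (A.final (p w) = .moon ∨ B.final (q w) = .moon)) :
    C.Profile w (.nymphet (n ^^^ m)) (some (.nymphet (n ^^^ m))) := by
  refine .nymphet _ (hC.final_unassigned hw hf hn fun h => hm h.1) ?_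
  rw [hC.keptValues hw, hA, hB, nimSum_singleton_left, nimShift_singleton]

/-- The addition table, with the information whether the algorithm returns a value. -/
theorem IsCart.exists_profile_add (hC : IsCart A B C p q) {w : W} (hw : w ∉ C.gray)
    {v v' : Value} {o o' : Option Value} (hA : A.Profile (p w) v o) (hB : B.Profile (q w) v' o') :
    ∃ r, C.Profile w (v.add v') r ∧ (o ≠ none → o' ≠ none → r = some (v.add v')) := by
  have hfull : A.final (p w) = .fullMoon ∨ B.final (q w) = .fullMoon →
      C.Profile w .fullMoon (some .fullMoon) := fun h => .fullMoon ((hC.fullMoon_iff hw).2 h)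
  have ret : ∀ {u}, C.Profile w u (some u) → u = v.add v' →
      ∃ r, C.Profile w (v.add v') r ∧ (o ≠ none → o' ≠ none → r = some (v.add v')) := by
    rintro u h rfl
    exact ⟨_, h, fun _ _ => rfl⟩
  have ret_hidden : ∀ {u}, (∃ r, C.Profile w u r) → u = v.add v' → o = none ∨ o' = none →
      ∃ r, C.Profile w (v.add v') r ∧ (o ≠ none → o' ≠ none → r = some (v.add v')) := by
    rintro u ⟨r, h⟩ rfl ho
    exact ⟨r, h, fun h₁ h₂ => absurd ho (by tauto)⟩
  by_cases hAf : A.final (p w) = .fullMoon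
  · refine ret (hfull (.inl hAf)) ?_
    cases hA <;> first | rfl | simp_all
  by_cases hBf : B.final (q w) = .fullMoon
  · refine ret (hfull (.inr hBf)) ?_
    cases hB <;> first | (cases v <;> rfl) | simp_all
  have hf : C.final w ≠ .fullMoon := by
    rw [Ne, hC.fullMoon_iff hw, not_or]
    exact ⟨hAf, hBf⟩
  have hinfL : A.keptValues (p w) = ∅ →
      C.Profile w (.infinity (nimSum (A.directValues (p w)) (B.keptValues (q w))))
        (some (.infinity (nimSum (A.directValues (p w)) (B.keptValues (q w))))) := by
    intro h
    rw [nimSum_comm]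
    exact hC.symm.profile_infinity hw hf h
  have hinfR := hC.profile_infinity hw hf
  have hmoon := hC.profile_moon hw hf
  have hhid := hC.profile_hiddenMoon hw hf
  have hnym := fun n m => hC.profile_nymphet hw hf (n := n) (m := m)
  have hne : ∀ {S : Set ℕ} {n : ℕ}, S = {n} → S.Nonempty := by
    rintro S n rfl
    exact Set.singleton_nonempty n
  cases hA with
  | fullMoon h => exact absurd h hAf
  | nim n h hk =>
    cases hB with
    | fullMoon h' => exact absurd h' hBf
    | nim m h' hk' => exact ret (.nim _ (hC.final_nim h h') (by
        rw [hC.keptValues hw, hk, hk', nimSum_singleton_left, nimShift_singleton])) rfl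
    | moon h' hk' => exact ret (hmoon (.inr h') (hne hk) hk') (by
        rw [hk, nimSum_singleton_left]; rfl)
    | infinity h' hk' => exact ret (hinfR hk') (by rw [hk, nimSum_singleton_left]; rfl)
    | nymphet m h' hk' => exact ret (hnym n m hk hk' (.inr (by simp [h'])) (by simp [h, h'])) rfl
    | hiddenMoon h' hk' hs => exact ret_hidden (hhid (hne hk) hk' (.inr hs)) (by
        rw [hk, nimSum_singleton_left]; rfl) (.inr rfl)
  | moon h hk =>
    cases hB with
    | fullMoon h' => exact absurd h' hBf
    | nim m h' hk' => exact ret (hmoon (.inl h) hk (hne hk')) (by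
        rw [hk', nimSum_singleton_right]; rfl)
    | moon h' hk' => exact ret (hmoon (.inl h) hk hk') rfl
    | infinity h' hk' => exact ret (hinfR hk') rfl
    | nymphet m h' hk' => exact ret (hmoon (.inl h) hk (hne hk')) (by
        rw [hk', nimSum_singleton_right]; rfl)
    | hiddenMoon h' hk' hs => exact ret (hmoon (.inl h) hk hk') rfl
  | infinity h hk =>
    cases hB with
    | fullMoon h' => exact absurd h' hBf
    | nim m h' hk' => exact ret (hinfL hk) (by rw [hk', nimSum_singleton_right]; rfl)
    | moon h' hk' => exact ret (hinfL hk) rfl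
    | infinity h' hk' => exact ret (hinfL hk) (by rw [hk', nimSum_empty]; rfl)
    | nymphet m h' hk' => exact ret (hinfL hk) (by rw [hk', nimSum_singleton_right]; rfl)
    | hiddenMoon h' hk' hs => exact ret (hinfL hk) rfl
  | nymphet n h hk =>
    cases hB with
    | fullMoon h' => exact absurd h' hBf
    | nim m h' hk' => exact ret (hnym n m hk hk' (.inl (by simp [h])) (by simp [h, h'])) rfl
    | moon h' hk' => exact ret (hmoon (.inr h') (hne hk) hk') (by
        rw [hk, nimSum_singleton_left]; rfl)
    | infinity h' hk' => exact ret (hinfR hk') (by rw [hk, nimSum_singleton_left]; rfl)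
    | nymphet m h' hk' => exact ret (hnym n m hk hk' (.inl (by simp [h])) (by simp [h, h'])) rfl
    | hiddenMoon h' hk' hs => exact ret_hidden (hhid (hne hk) hk' (.inr hs)) (by
        rw [hk, nimSum_singleton_left]; rfl) (.inr rfl)
  | hiddenMoon h hk hs =>
    cases hB with
    | fullMoon h' => exact absurd h' hBf
    | nim m h' hk' => exact ret_hidden (hhid hk (hne hk') (.inl hs)) (by
        rw [hk', nimSum_singleton_right]; rfl) (.inl rfl)
    | moon h' hk' => exact ret_hidden (hhid hk hk' (.inl hs)) rfl (.inl rfl)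
    | infinity h' hk' => exact ret (hinfR hk') rfl
    | nymphet m h' hk' => exact ret_hidden (hhid hk (hne hk') (.inl hs)) (by
        rw [hk', nimSum_singleton_right]; rfl) (.inl rfl)
    | hiddenMoon h' hk' hs' => exact ret_hidden (hhid hk hk' (.inl hs)) rfl (.inl rfl)

end

end CarryOnDigraph

theorem mainTheorem1 {V U : Type*} [Finite V] [Finite U]
    (A : CarryOnDigraph V) (B : CarryOnDigraph U)
    (x : V) (y : U) (hx : x ∉ A.gray) (hy : y ∉ B.gray) :
    (A.cartProduct B).grundy (CarryOnDigraph.pair A B x y hx hy) =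
        (A.grundy x).add (B.grundy y) ∧
    ∀ a b : CarryOnDigraph.Value, A.output x = some a → B.output y = some b →
      (A.cartProduct B).output (CarryOnDigraph.pair A B x y hx hy) = some (a.add b) := by
  obtain ⟨v, o, hA⟩ := CarryOnDigraph.exists_profile hx
  obtain ⟨v', o', hB⟩ := CarryOnDigraph.exists_profile hy
  have hC := CarryOnDigraph.isCart_cartProduct A B
  obtain ⟨r, hr, h⟩ := hC.exists_profile_add
    (w := CarryOnDigraph.pair A B x y hx hy) (hC.white.2 ⟨hx, hy⟩) hA hB
  refine ⟨?_, fun a b ha hb => ?_⟩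
  · rw [hr.output_eq.2, hA.output_eq.2, hB.output_eq.2]
  · have hv : A.grundy x = a := by rw [CarryOnDigraph.grundy, ha]; rfl
    have hv' : B.grundy y = b := by rw [CarryOnDigraph.grundy, hb]; rfl
    rw [hA.output_eq.1] at ha
    rw [hB.output_eq.1] at hb
    rw [hr.output_eq.1, h (by simp [ha]) (by simp [hb]), ← hv, ← hv', hA.output_eq.2,
      hB.output_eq.2]
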